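/- Let $H=H_N$ be an $N\times N$ Wigner matrix of one of the following two types, where $\nu,\widetilde\nu$ are fixed centered probability measures on $\mathbb R$ (not depending on $N$). (Symmetric case) $h_{\ell k}=h_{k\ell}=N^{-1/2}x_{\ell k}$ for $\ell\le k$, where the real random variables $x_{\ell k}$, $\ell\le k$, are independent, those with $\ell<k$ have law $\nu$ of variance $1$, and the $x_{\ell\ell}$ have law $\widetilde\nu$ of variance $2$. (Hermitian case) $h_{\ell k}=\overline{h_{k\ell}}=N^{-1/2}(x_{\ell k}+i y_{\ell k})$ for $\ell<k$ and $h_{\ell\ell}=N^{-1/2}x_{\ell\ell}$, where all the real random variables $x_{\ell k}$ ($\ell\le k$) and $y_{\ell k}$ ($\ell<k$) are independent, $x_{\ell k}$ and $y_{\ell k}$ with $\ell<k$ have law $\nu$ of variance $\frac12$, and the $x_{\ell\ell}$ have law $\widetilde\nu$ of variance $1$. Assume that $\nu$ and $\widetilde\nu$ have Gaussian decay: for some $\delta_0>0$, $$\int_{\mathbb R} e^{\delta_0x^2}\,d\nu(x)<\infty,\qquad \int_{\mathbb R} e^{\delta_0x^2}\,d\widetilde\nu(x)<\infty .$$ Theorem.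 In either case, for any $E$ with $|E|<2$, any fixed $K\in\mathbb R$ and any $2<p<\infty$ there are constants $C,c>0$, $M_0$ and $N_0$ (depending on $\nu,\widetilde\nu,E,K,p$) such that for all real $M\ge M_0$ and all integers $N\ge N_0$ $$\mathbb P\Big\{\exists\, \mathbf v\in\mathbb C^N,\ \lambda\in\mathbb R:\ H\mathbf v=\lambda\mathbf v,\ |\lambda-E|\le \frac KN,\ \|\mathbf v\|_2=1,\ \|\mathbf v\|_p\ge M N^{-\frac12+\frac1p}\Big\}\le C e^{-c\sqrt M}.$$ -/

import Mathlib

open MeasureTheory ProbabilityTheory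

namespace WignerDeloc

/-- A probability law `ν` on the real line that is centered and has variance `s`. -/
structure IsCenteredLaw (ν : Measure ℝ) (s : ℝ) : Prop where
  isProbabilityMeasure : IsProbabilityMeasure ν
  mean_eq : ∫ x, x ∂ν = 0
  variance_eq : variance id ν = s

/-- Gaussian decay of the off-diagonal law `ν` and of the diagonal law `νd`:
`∫ exp (δ₀ x²) dν < ∞` and `∫ exp (δ₀ x²) dνd < ∞` for some `δ₀ > 0`. -/
def HasGaussianDecay (ν νd : Measure ℝ) : Prop :=
  ∃ δ₀ : ℝ, 0 < δ₀ ∧ Integrable (fun x : ℝ => Real.exp (δ₀ * x ^ 2)) ν ∧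
    Integrable (fun x : ℝ => Real.exp (δ₀ * x ^ 2)) νd

/-- The entries of a real symmetric Wigner matrix: the `x l k` with `l ≤ k` are independent
random variables, those with `l < k` have law `ν`, and the `x l l` have law `νd`.
The values `x l k` with `l > k` play no role. -/
structure IsSymmetricEntries {Ω : Type*} [MeasurableSpace Ω] (P : Measure Ω) {N : ℕ}
    (ν νd : Measure ℝ) (x : Fin N → Fin N → Ω → ℝ) : Prop where
  measurable : ∀ l k, l ≤ k → Measurable (x l k)
  law_offdiag : ∀ l k, l < k → P.map (x l k) = ν
  law_diag : ∀ l, P.map (x l l) = νd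
  indep : iIndepFun (fun q : {q : Fin N × Fin N // q.1 ≤ q.2} => x q.1.1 q.1.2) P

/-- The entries of a complex hermitian Wigner matrix: the `x l k` with `l ≤ k` and the `y l k`
with `l < k` are all independent; the `x l k` and `y l k` with `l < k` have law `ν`, and the
`x l l` have law `νd`. The remaining values of `x` and `y` play no role. -/
structure IsHermitianEntries {Ω : Type*} [MeasurableSpace Ω] (P : Measure Ω) {N : ℕ}
    (ν νd : Measure ℝ) (x y : Fin N → Fin N → Ω → ℝ) : Prop where
  measurable_re : ∀ l k, l ≤ k → Measurable (x l k)
  measurable_im : ∀ l k, l < k → Measurable (y l k)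
  law_re : ∀ l k, l < k → P.map (x l k) = ν
  law_im : ∀ l k, l < k → P.map (y l k) = ν
  law_diag : ∀ l, P.map (x l l) = νd
  indep : iIndepFun
    (Sum.elim (fun q : {q : Fin N × Fin N // q.1 ≤ q.2} => x q.1.1 q.1.2)
      (fun q : {q : Fin N × Fin N // q.1 < q.2} => y q.1.1 q.1.2)) P

/-- The real symmetric matrix `h l k = N ^ (-1/2) * x l k` for `l ≤ k`, extended by symmetry
(and viewed as a matrix with complex entries). -/
noncomputable def symmetricMatrix {N : ℕ} (x : Fin N → Fin N → ℝ) :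
    Matrix (Fin N) (Fin N) ℂ :=
  Matrix.of fun l k => (((N : ℝ) ^ (-(1 / 2) : ℝ) * x (min l k) (max l k) : ℝ) : ℂ)

/-- The hermitian matrix `h l k = N ^ (-1/2) * (x l k + i y l k)` for `l < k`, with real diagonal
`h l l = N ^ (-1/2) * x l l`, extended by `h l k = conj (h k l)`. -/
noncomputable def hermitianMatrix {N : ℕ} (x y : Fin N → Fin N → ℝ) :
    Matrix (Fin N) (Fin N) ℂ :=
  Matrix.of fun l k =>
    (((N : ℝ) ^ (-(1 / 2) : ℝ) : ℝ) : ℂ) *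
      (if l < k then (x l k : ℂ) + Complex.I * (y l k : ℂ)
       else if k < l then (x k l : ℂ) - Complex.I * (y k l : ℂ)
       else (x l l : ℂ))

/-- The `ℓ^p` norm of a vector in `ℂ^N`. -/
noncomputable def ellNorm {N : ℕ} (p : ℝ) (v : Fin N → ℂ) : ℝ :=
  ‖(WithLp.toLp (ENNReal.ofReal p) v : PiLp (ENNReal.ofReal p) (fun _ : Fin N => ℂ))‖

/-- `H` has an `ℓ²`-normalized eigenvector `v`, with eigenvalue within `K / N` of `E`, such that
`‖v‖_p ≥ M N ^ (-1/2 + 1/p)`. -/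
def HasLocalizedEigenvector {N : ℕ} (H : Matrix (Fin N) (Fin N) ℂ) (E K p M : ℝ) : Prop :=
  ∃ (v : Fin N → ℂ) (lam : ℝ), H.mulVec v = (lam : ℂ) • v ∧ |lam - E| ≤ K / N ∧
    ellNorm 2 v = 1 ∧ M * (N : ℝ) ^ (-(1 / 2) + 1 / p : ℝ) ≤ ellNorm p v

end WignerDeloc

/-!
The coordinates of a normalized eigenvector `v` with eigenvalue within `K / N` of `E` are bounded by
the resolvent `G(z) = (H - z)⁻¹`: for every `η ≥ K / N` one has `|v_j|² ≤ 2 η Im G_jj(E + iη)`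
(`normSq_eigenvector_le`). If `G_jj(E + iη)` is bounded, then `N |v_j|²` is at most of order `N η`. It
therefore suffices to show that at every dyadic scale `η ≥ Q / N` a given diagonal resolvent entry is
bounded, except with probability exponentially small in `√(N η)` (`exists_resolvent_tail`). A row with
`N |v_j|²` much larger than `N η` must have a large resolvent entry at some coarser scale, so a large
`ℓᵖ` norm forces a weighted count of large entries to be large (`localized_le_sum`). Markov's
inequality for this count, started at the scale with `N η` of order `M²`, gives the theorem
(`exists_delocalization`).

The resolvent entries are controlled by the Schur complement formula (`schur`): `G_jj` is the inverse
of `H_jj - z - a* G⁽ʲ⁾ a`, where `a` is the `j`-th column and `G⁽ʲ⁾` the resolvent of the minor, which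
is independent of `a`. A Hanson-Wright inequality (`quadratic_tail_pi`), proved with an exponential
supermartingale, shows that `a* G⁽ʲ⁾ a` is close to the normalized trace of `G⁽ʲ⁾`, hence to
`m = N⁻¹ Tr G`. The error is governed by the Hilbert-Schmidt norm of `G⁽ʲ⁾`, which by the Ward identity
is `(Im Tr G⁽ʲ⁾ / η)^(1/2)`. Thus `G_jj ≈ -1 / (z + m)`, and averaging over `j` yields the approximate
self-consistent equation `m ≈ -1 / (z + m)`. For `|E| < 2` this equation is stable (`stability`): since
the discriminant `z² - 4` has negative real part, an approximate solution is bounded with imaginary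
part bounded from below.

The bound on the trace needed for the concentration inequality at scale `η / 2` is inherited from scale
`η`, because diagonal resolvent entries at most double when `η` is halved (`resolvent_half_scale`). This
gives an induction on scales starting from `η = 1` (`regular_step`). Near the finest scales some rows
do violate the concentration bound, so one cannot ask for it in all rows simultaneously. Instead the
contribution of the bad rows to the average is dominated by a weighted count of past bad events, the
`overflow`, whose average over the rows is small with high probability by Markov's inequality.
-/

namespace WignerDeloc

open Matrix Finset

/-! ### The resolvent of a Hermitian matrix -/

variable {N : ℕ}

/-- The resolvent `(H - z)⁻¹`. -/
noncomputable def resolvent (H : Matrix (Fin N) (Fin N) ℂ) (z : ℂ) : Matrix (Fin N) (Fin N) ℂ :=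
  (H - z • (1 : Matrix (Fin N) (Fin N) ℂ))⁻¹

lemma ofReal_sub_ne_zero {z : ℂ} (hz : 0 < z.im) (t : ℝ) : (t : ℂ) - z ≠ 0 := by
  intro h
  have := congrArg Complex.im h
  simp at this
  linarith

section Spectral

variable {H : Matrix (Fin N) (Fin N) ℂ} (hH : H.IsHermitian) {z : ℂ} (hz : 0 < z.im)
include hH hz

lemma mul_spectral_resolvent :
    (H - z • (1 : Matrix (Fin N) (Fin N) ℂ)) *
      ((hH.eigenvectorUnitary : Matrix (Fin N) (Fin N) ℂ) *
        diagonal (fun i => ((hH.eigenvalues i : ℂ) - z)⁻¹) *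
        star (hH.eigenvectorUnitary : Matrix (Fin N) (Fin N) ℂ)) = 1 := by
  set U : Matrix (Fin N) (Fin N) ℂ := (hH.eigenvectorUnitary : Matrix (Fin N) (Fin N) ℂ) with hU
  have hUU : star U * U = 1 := Unitary.coe_star_mul_self _
  have hUU' : U * star U = 1 := Unitary.coe_mul_star_self _
  have h1 : H - z • (1 : Matrix (Fin N) (Fin N) ℂ)
      = U * diagonal (fun i => (hH.eigenvalues i : ℂ) - z) * star U := by
    have h2 := hH.spectral_theorem
    rw [Unitary.conjStarAlgAut_apply] at h2
    have h3 : (diagonal (fun i => (hH.eigenvalues i : ℂ) - z) : Matrix (Fin N) (Fin N) ℂ)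
        = diagonal (RCLike.ofReal ∘ hH.eigenvalues) - z • 1 := by
      ext i j
      by_cases hij : i = j <;> simp [diagonal, one_apply, hij]
    rw [h3, mul_sub, sub_mul, ← h2]
    simp [hUU']
  rw [h1]
  have : ∀ A B : Matrix (Fin N) (Fin N) ℂ, U * A * star U * (U * B * star U)
      = U * (A * B) * star U := by
    intro A B
    calc _ = U * A * (star U * U) * B * star U := by simp only [mul_assoc]
      _ = _ := by rw [hUU]; simp only [mul_assoc, mul_one]
  rw [this, diagonal_mul_diagonal]
  have h4 : (fun i => ((hH.eigenvalues i : ℂ) - z) * ((hH.eigenvalues i : ℂ) - z)⁻¹)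
      = fun _ => (1 : ℂ) := by
    funext i
    exact mul_inv_cancel₀ (ofReal_sub_ne_zero hz _)
  rw [h4]
  simp [hUU']

lemma resolvent_eq_spectral :
    resolvent H z = (hH.eigenvectorUnitary : Matrix (Fin N) (Fin N) ℂ) *
        diagonal (fun i => ((hH.eigenvalues i : ℂ) - z)⁻¹) *
        star (hH.eigenvectorUnitary : Matrix (Fin N) (Fin N) ℂ) :=
  Matrix.inv_eq_right_inv (mul_spectral_resolvent hH hz)

lemma isUnit_det_sub : IsUnit (H - z • (1 : Matrix (Fin N) (Fin N) ℂ)).det :=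
  Matrix.isUnit_det_of_right_inverse (mul_spectral_resolvent hH hz)

lemma sub_mul_resolvent : (H - z • (1 : Matrix (Fin N) (Fin N) ℂ)) * resolvent H z = 1 :=
  Matrix.mul_nonsing_inv _ (isUnit_det_sub hH hz)

lemma resolvent_mul_sub : resolvent H z * (H - z • (1 : Matrix (Fin N) (Fin N) ℂ)) = 1 :=
  Matrix.nonsing_inv_mul _ (isUnit_det_sub hH hz)

omit hz in
/-- The diagonal resolvent entries are Stieltjes transforms of probability weights on the
spectrum. -/
lemma exists_spectral_weights (j : Fin N) :
    ∃ (w lam : Fin N → ℝ), (∀ i, 0 ≤ w i) ∧ ∑ i, w i = 1 ∧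
      ∀ z : ℂ, 0 < z.im → resolvent H z j j = ∑ i, (w i : ℂ) * ((lam i : ℂ) - z)⁻¹ := by
  set U : Matrix (Fin N) (Fin N) ℂ := (hH.eigenvectorUnitary : Matrix (Fin N) (Fin N) ℂ) with hU
  have hUU' : U * star U = 1 := Unitary.coe_mul_star_self _
  refine ⟨fun i => Complex.normSq (U j i), hH.eigenvalues, fun i => Complex.normSq_nonneg _,
    ?_, ?_⟩
  · have := congrFun (congrFun hUU' j) j
    rw [mul_apply] at this
    simp only [star_apply, one_apply_eq, RCLike.star_def, Complex.mul_conj] at this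
    exact_mod_cast this
  · intro z hz
    rw [resolvent_eq_spectral hH hz, ← hU, mul_apply]
    refine Finset.sum_congr rfl fun i _ => ?_
    rw [mul_diagonal, star_apply, Complex.normSq_eq_conj_mul_self, RCLike.star_def]
    ring

lemma conjTranspose_resolvent_mul_sub :
    (resolvent H z)ᴴ * (H - (starRingEnd ℂ z) • (1 : Matrix (Fin N) (Fin N) ℂ)) = 1 := by
  have h := congrArg conjTranspose (sub_mul_resolvent hH hz)
  rw [conjTranspose_mul, conjTranspose_sub, hH.eq, conjTranspose_smul, conjTranspose_one] at h
  exact h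

lemma sub_mul_conjTranspose_resolvent :
    (H - (starRingEnd ℂ z) • (1 : Matrix (Fin N) (Fin N) ℂ)) * (resolvent H z)ᴴ = 1 := by
  have h := congrArg conjTranspose (resolvent_mul_sub hH hz)
  rw [conjTranspose_mul, conjTranspose_sub, hH.eq, conjTranspose_smul, conjTranspose_one] at h
  exact h

/-- The Ward identity for the columns of the resolvent. -/
lemma ward_col (j : Fin N) :
    z.im * ∑ k, Complex.normSq (resolvent H z k j) = (resolvent H z j j).im := by
  set G := resolvent H z with hG
  have h1 : G - Gᴴ = (z - starRingEnd ℂ z) • (Gᴴ * G) := by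
    calc G - Gᴴ = (Gᴴ * (H - (starRingEnd ℂ z) • (1 : Matrix (Fin N) (Fin N) ℂ))) * G
          - Gᴴ * ((H - z • (1 : Matrix (Fin N) (Fin N) ℂ)) * G) := by
          rw [conjTranspose_resolvent_mul_sub hH hz, sub_mul_resolvent hH hz]; simp
      _ = _ := by
          rw [mul_assoc, ← mul_sub, ← sub_mul, sub_sub_sub_cancel_left, ← sub_smul]
          simp
  have h2 := congrArg Complex.im (congrFun (congrFun h1 j) j)
  rw [Matrix.sub_apply, Matrix.smul_apply, mul_apply, conjTranspose_apply] at h2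
  have h3 : ∑ k, Gᴴ j k * G k j = ((∑ k, Complex.normSq (G k j) : ℝ) : ℂ) := by
    push_cast
    refine Finset.sum_congr rfl fun k _ => ?_
    rw [conjTranspose_apply, Complex.normSq_eq_conj_mul_self, RCLike.star_def]
  rw [h3] at h2
  simp at h2
  linarith

/-- The Ward identity for the rows of the resolvent. -/
lemma ward_row (j : Fin N) :
    z.im * ∑ k, Complex.normSq (resolvent H z j k) = (resolvent H z j j).im := by
  set G := resolvent H z with hG
  have h1 : G - Gᴴ = (z - starRingEnd ℂ z) • (G * Gᴴ) := by
    calc G - Gᴴ = G * ((H - (starRingEnd ℂ z) • (1 : Matrix (Fin N) (Fin N) ℂ)) * Gᴴ)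
          - (G * (H - z • (1 : Matrix (Fin N) (Fin N) ℂ))) * Gᴴ := by
          rw [sub_mul_conjTranspose_resolvent hH hz, resolvent_mul_sub hH hz]; simp
      _ = _ := by
          rw [mul_assoc, ← mul_sub, ← sub_mul, sub_sub_sub_cancel_left, ← sub_smul]
          simp
  have h2 := congrArg Complex.im (congrFun (congrFun h1 j) j)
  rw [Matrix.sub_apply, Matrix.smul_apply, mul_apply, conjTranspose_apply] at h2
  have h3 : ∑ k, G j k * Gᴴ k j = ((∑ k, Complex.normSq (G j k) : ℝ) : ℂ) := by
    push_cast
    refine Finset.sum_congr rfl fun k _ => ?_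
    rw [conjTranspose_apply, Complex.normSq_eq_conj_mul_self, RCLike.star_def, mul_comm]
  rw [h3] at h2
  simp at h2
  linarith

lemma resolvent_im_nonneg (j : Fin N) : 0 ≤ (resolvent H z j j).im := by
  rw [← ward_col hH hz j]
  exact mul_nonneg hz.le (Finset.sum_nonneg fun _ _ => Complex.normSq_nonneg _)

lemma norm_resolvent_diag_le (j : Fin N) : ‖resolvent H z j j‖ ≤ 1 / z.im := by
  have h1 : z.im * Complex.normSq (resolvent H z j j) ≤ ‖resolvent H z j j‖ := by
    calc _ ≤ z.im * ∑ k, Complex.normSq (resolvent H z k j) := by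
          gcongr
          exact Finset.single_le_sum (f := fun k => Complex.normSq (resolvent H z k j))
            (fun _ _ => Complex.normSq_nonneg _) (Finset.mem_univ j)
      _ = (resolvent H z j j).im := ward_col hH hz j
      _ ≤ _ := (le_abs_self _).trans (Complex.abs_im_le_norm _)
  rw [Complex.normSq_eq_norm_sq] at h1
  rw [le_div_iff₀ hz]
  by_contra! h
  have h0 : 0 < ‖resolvent H z j j‖ := by
    by_contra! h0
    have : ‖resolvent H z j j‖ = 0 := le_antisymm h0 (norm_nonneg _)
    rw [this] at h; norm_num at h
  nlinarith

/-- A normalized eigenvector whose eigenvalue is within `Im z` of `Re z` has coordinates controlled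
by the diagonal resolvent entries at `z`. -/
lemma normSq_eigenvector_le {v : Fin N → ℂ} {lam : ℝ} (hv : H.mulVec v = (lam : ℂ) • v)
    (hnorm : ∑ k, Complex.normSq (v k) = 1) (hlam : |lam - z.re| ≤ z.im) (j : Fin N) :
    Complex.normSq (v j) ≤ 2 * z.im * (resolvent H z j j).im := by
  have h1 : (H - z • (1 : Matrix (Fin N) (Fin N) ℂ)).mulVec v = ((lam : ℂ) - z) • v := by
    rw [sub_mulVec, hv, smul_mulVec, one_mulVec, sub_smul]
  have h2 : v = ((lam : ℂ) - z) • (resolvent H z).mulVec v := by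
    rw [← mulVec_smul, ← h1, mulVec_mulVec, resolvent_mul_sub hH hz, one_mulVec]
  have h3 : v j = ((lam : ℂ) - z) * ∑ k, resolvent H z j k * v k := by
    conv_lhs => rw [h2]
    rfl
  have h4 : Complex.normSq (∑ k, resolvent H z j k * v k)
      ≤ (∑ k, Complex.normSq (resolvent H z j k)) * ∑ k, Complex.normSq (v k) := by
    simp only [Complex.normSq_eq_norm_sq]
    calc ‖∑ k, resolvent H z j k * v k‖ ^ 2
        ≤ (∑ k, ‖resolvent H z j k‖ * ‖v k‖) ^ 2 := by
          gcongr
          refine (norm_sum_le _ _).trans (le_of_eq ?_)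
          simp
      _ ≤ _ := Finset.sum_mul_sq_le_sq_mul_sq _ _ _
  rw [hnorm, mul_one] at h4
  have h5 : Complex.normSq ((lam : ℂ) - z) ≤ 2 * z.im ^ 2 := by
    rw [Complex.normSq_apply]
    simp only [Complex.sub_re, Complex.ofReal_re, Complex.sub_im, Complex.ofReal_im]
    have := sq_le_sq' (neg_le_of_abs_le hlam) (le_of_abs_le hlam)
    nlinarith
  rw [h3, Complex.normSq_mul, ← ward_row hH hz j]
  calc _ ≤ 2 * z.im ^ 2 * ∑ k, Complex.normSq (resolvent H z j k) := by
        gcongr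
        exact Complex.normSq_nonneg _
    _ = _ := by ring

end Spectral

lemma im_mk_inv (E η t : ℝ) : (((t : ℂ) - ⟨E, η⟩)⁻¹).im = η / ((t - E) ^ 2 + η ^ 2) := by
  rw [Complex.inv_im, Complex.normSq_apply]
  simp
  ring

section Scale

variable {H : Matrix (Fin N) (Fin N) ℂ} (hH : H.IsHermitian) {E η : ℝ} (hη : 0 < η)
include hH hη

/-- Comparison of the diagonal resolvent entries at the scales `η` and `η / 2`. -/
lemma resolvent_half_scale (j : Fin N) :
    ‖resolvent H ⟨E, η / 2⟩ j j‖ ≤ 2 * ‖resolvent H ⟨E, η⟩ j j‖ ∧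
    (resolvent H ⟨E, η / 2⟩ j j).im ≤ 2 * (resolvent H ⟨E, η⟩ j j).im ∧
    (resolvent H ⟨E, η⟩ j j).im ≤ 2 * (resolvent H ⟨E, η / 2⟩ j j).im := by
  obtain ⟨w, lam, hw, -, hG⟩ := exists_spectral_weights hH j
  have hη2 : 0 < η / 2 := by positivity
  have e1 := hG ⟨E, η⟩ hη
  have e2 := hG ⟨E, η / 2⟩ hη2
  have i1 : (resolvent H ⟨E, η⟩ j j).im = ∑ i, w i * (η / ((lam i - E) ^ 2 + η ^ 2)) := by
    rw [e1, Complex.im_sum]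
    refine Finset.sum_congr rfl fun i _ => ?_
    rw [Complex.im_ofReal_mul, im_mk_inv]
  have i2 : (resolvent H ⟨E, η / 2⟩ j j).im
      = ∑ i, w i * ((η / 2) / ((lam i - E) ^ 2 + (η / 2) ^ 2)) := by
    rw [e2, Complex.im_sum]
    refine Finset.sum_congr rfl fun i _ => ?_
    rw [Complex.im_ofReal_mul, im_mk_inv]
  have hpos : ∀ i, 0 < (lam i - E) ^ 2 + η ^ 2 := fun i => by positivity
  have hpos2 : ∀ i, 0 < (lam i - E) ^ 2 + (η / 2) ^ 2 := fun i => by positivity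
  have hdiff : ‖resolvent H ⟨E, η⟩ j j - resolvent H ⟨E, η / 2⟩ j j‖
      ≤ (resolvent H ⟨E, η⟩ j j).im := by
    rw [e1, e2, ← Finset.sum_sub_distrib, ← e1, i1]
    refine (norm_sum_le _ _).trans (Finset.sum_le_sum fun i _ => ?_)
    rw [← mul_sub, norm_mul, Complex.norm_real, Real.norm_of_nonneg (hw i)]
    refine mul_le_mul_of_nonneg_left ?_ (hw i)
    have n1 := ofReal_sub_ne_zero (z := ⟨E, η⟩) hη (lam i)
    have n2 := ofReal_sub_ne_zero (z := ⟨E, η / 2⟩) hη2 (lam i)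
    rw [inv_sub_inv n1 n2, norm_div, norm_mul]
    have a1 : ‖(lam i : ℂ) - ⟨E, η⟩‖ ^ 2 = (lam i - E) ^ 2 + η ^ 2 := by
      rw [← Complex.normSq_eq_norm_sq, Complex.normSq_apply]; simp; ring
    have a2 : ‖(lam i : ℂ) - ⟨E, η / 2⟩‖ ^ 2 = (lam i - E) ^ 2 + (η / 2) ^ 2 := by
      rw [← Complex.normSq_eq_norm_sq, Complex.normSq_apply]; simp; ring
    have a3 : ‖((lam i : ℂ) - ⟨E, η / 2⟩) - (lam i - ⟨E, η⟩)‖ = η / 2 := by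
      have : ((lam i : ℂ) - ⟨E, η / 2⟩) - (lam i - ⟨E, η⟩) = ((η / 2 : ℝ) : ℂ) * Complex.I := by
        apply Complex.ext <;> simp
        ring
      rw [this, norm_mul, Complex.norm_I, Complex.norm_real, Real.norm_of_nonneg hη2.le, mul_one]
    rw [a3]
    have b1 : 0 < ‖(lam i : ℂ) - ⟨E, η⟩‖ := norm_pos_iff.mpr n1
    have b2 : 0 < ‖(lam i : ℂ) - ⟨E, η / 2⟩‖ := norm_pos_iff.mpr n2
    have b3 : ‖(lam i : ℂ) - ⟨E, η⟩‖ ≤ 2 * ‖(lam i : ℂ) - ⟨E, η / 2⟩‖ := by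
      refine le_of_sq_le_sq ?_ (by positivity)
      rw [mul_pow, a1, a2]
      nlinarith [sq_nonneg (lam i - E)]
    rw [← a1, div_le_div_iff₀ (by positivity) (by positivity)]
    nlinarith [mul_le_mul_of_nonneg_left b3 b1.le]
  refine ⟨?_, ?_, ?_⟩
  · have h1 : ‖resolvent H ⟨E, η / 2⟩ j j‖ ≤ ‖resolvent H ⟨E, η⟩ j j‖
        + ‖resolvent H ⟨E, η⟩ j j - resolvent H ⟨E, η / 2⟩ j j‖ := by
      have := norm_sub_le (resolvent H ⟨E, η⟩ j j)
        (resolvent H ⟨E, η⟩ j j - resolvent H ⟨E, η / 2⟩ j j)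
      simpa using this
    have h2 : (resolvent H ⟨E, η⟩ j j).im ≤ ‖resolvent H ⟨E, η⟩ j j‖ :=
      (le_abs_self _).trans (Complex.abs_im_le_norm _)
    linarith
  · rw [i1, i2, Finset.mul_sum]
    refine Finset.sum_le_sum fun i _ => ?_
    rw [mul_left_comm]
    refine mul_le_mul_of_nonneg_left ?_ (hw i)
    rw [← mul_div_assoc, div_le_div_iff₀ (hpos2 i) (hpos i)]
    nlinarith [mul_nonneg hη.le (sq_nonneg (lam i - E))]
  · rw [i1, i2, Finset.mul_sum]
    refine Finset.sum_le_sum fun i _ => ?_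
    rw [mul_left_comm]
    refine mul_le_mul_of_nonneg_left ?_ (hw i)
    rw [← mul_div_assoc, div_le_div_iff₀ (hpos i) (hpos2 i)]
    have : 0 < η ^ 3 := by positivity
    nlinarith

end Scale

/-- The matrix `H` with its `j`-th row and column replaced by zero. -/
def minor (H : Matrix (Fin N) (Fin N) ℂ) (j : Fin N) : Matrix (Fin N) (Fin N) ℂ :=
  Matrix.of fun k l => if k = j ∨ l = j then 0 else H k l

/-- The `j`-th column of `H` without its diagonal entry. -/
def offCol (H : Matrix (Fin N) (Fin N) ℂ) (j : Fin N) : Fin N → ℂ :=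
  fun k => if k = j then 0 else H k j

/-- The sesquilinear form `a* A a`. -/
def quadForm (A : Matrix (Fin N) (Fin N) ℂ) (a : Fin N → ℂ) : ℂ :=
  ∑ k, ∑ l, starRingEnd ℂ (a k) * A k l * a l

/-- The trace of `A` without its `j`-th diagonal entry. -/
def offTrace (A : Matrix (Fin N) (Fin N) ℂ) (j : Fin N) : ℂ :=
  ∑ k, if k = j then 0 else A k k

lemma isHermitian_minor {H : Matrix (Fin N) (Fin N) ℂ} (hH : H.IsHermitian) (j : Fin N) :
    (minor H j).IsHermitian := by
  ext k l
  simp only [minor, conjTranspose_apply, of_apply]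
  by_cases h : k = j ∨ l = j
  · rw [if_pos h, if_pos h.symm, star_zero]
  · rw [if_neg h, if_neg (fun h' => h h'.symm), ← conjTranspose_apply, hH.eq]

section Schur

variable {H : Matrix (Fin N) (Fin N) ℂ} (hH : H.IsHermitian) {z : ℂ} (hz : 0 < z.im)
include hH hz

/-- Away from row `j`, the equation `(H - z) u = f` reads `(H⁽ʲ⁾ - z) u' = f' - u_j a`, where primes
denote vectors with `j`-th coordinate erased. -/
lemma off_solution (j : Fin N) {u f : Fin N → ℂ}
    (hu : (H - z • (1 : Matrix (Fin N) (Fin N) ℂ)).mulVec u = f) :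
    (fun k => if k = j then 0 else u k) = (resolvent (minor H j) z).mulVec
      (fun k => if k = j then 0 else f k - u j * offCol H j k) := by
  have key : (minor H j - z • (1 : Matrix (Fin N) (Fin N) ℂ)).mulVec
      (fun k => if k = j then 0 else u k)
      = fun k => if k = j then 0 else f k - u j * offCol H j k := by
    funext k
    rw [sub_mulVec, smul_mulVec, one_mulVec]
    simp only [Pi.sub_apply, Pi.smul_apply, smul_eq_mul]
    by_cases hk : k = j
    · subst hk
      simp [mulVec, dotProduct, minor]
    · have h1 := congrFun hu k
      rw [sub_mulVec, smul_mulVec, one_mulVec] at h1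
      simp only [Pi.sub_apply, Pi.smul_apply, smul_eq_mul, mulVec, dotProduct] at h1
      simp only [mulVec, dotProduct, offCol, ← h1, minor, of_apply, false_or, hk, if_false]
      have h2 : ∑ l, H k l * u l = H k j * u j + ∑ l, (if l = j then 0 else H k l) *
          (if l = j then 0 else u l) := by
        rw [← Finset.add_sum_erase _ _ (Finset.mem_univ j),
          ← Finset.add_sum_erase Finset.univ (fun l => (if l = j then 0 else H k l) *
          (if l = j then 0 else u l)) (Finset.mem_univ j)]
        simp only [if_true, mul_zero, zero_add]
        congr 1
        refine Finset.sum_congr rfl fun l hl => ?_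
        rw [if_neg (Finset.ne_of_mem_erase hl), if_neg (Finset.ne_of_mem_erase hl)]
      rw [h2]
      ring
  rw [← key, mulVec_mulVec, resolvent_mul_sub (isHermitian_minor hH j) hz, one_mulVec]

lemma resolvent_col_eq (j : Fin N) :
    (H - z • (1 : Matrix (Fin N) (Fin N) ℂ)).mulVec (fun k => resolvent H z k j)
      = fun k => if k = j then 1 else 0 := by
  funext k
  have := congrFun (congrFun (sub_mul_resolvent hH hz) k) j
  rw [mul_apply, one_apply] at this
  exact this

/-- The resolvent of the minor applied to the removed column. -/
lemma resolvent_off_col (j k : Fin N) :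
    (if k = j then 0 else resolvent H z k j)
      = - resolvent H z j j * (resolvent (minor H j) z).mulVec (offCol H j) k := by
  have h := congrFun (off_solution hH hz j (resolvent_col_eq hH hz j)) k
  rw [h, ← smul_eq_mul, ← Pi.smul_apply, ← mulVec_smul]
  congr 2
  funext l
  by_cases hl : l = j <;> simp [hl, offCol]

/-- The Schur complement formula for diagonal resolvent entries. -/
lemma schur (j : Fin N) :
    resolvent H z j j * (H j j - z - quadForm (resolvent (minor H j) z) (offCol H j)) = 1 := by
  have h1 := congrFun (resolvent_col_eq hH hz j) j
  rw [if_pos rfl, sub_mulVec, smul_mulVec, one_mulVec] at h1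
  simp only [Pi.sub_apply, Pi.smul_apply, smul_eq_mul, mulVec, dotProduct] at h1
  have h2 : ∑ l, H j l * resolvent H z l j = H j j * resolvent H z j j
      + ∑ l, starRingEnd ℂ (offCol H j l) * (if l = j then 0 else resolvent H z l j) := by
    rw [← Finset.add_sum_erase _ _ (Finset.mem_univ j),
      ← Finset.add_sum_erase Finset.univ (fun l => starRingEnd ℂ (offCol H j l) *
      (if l = j then 0 else resolvent H z l j)) (Finset.mem_univ j)]
    simp only [if_true, mul_zero, zero_add]
    congr 1
    refine Finset.sum_congr rfl fun l hl => ?_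
    rw [if_neg (Finset.ne_of_mem_erase hl), offCol, if_neg (Finset.ne_of_mem_erase hl)]
    congr 1
    rw [← hH.apply j l]; rfl
  have h3 : ∑ l, starRingEnd ℂ (offCol H j l) * (if l = j then 0 else resolvent H z l j)
      = - resolvent H z j j * quadForm (resolvent (minor H j) z) (offCol H j) := by
    rw [quadForm, Finset.mul_sum]
    refine Finset.sum_congr rfl fun l _ => ?_
    rw [resolvent_off_col hH hz, mulVec, dotProduct, Finset.mul_sum, Finset.mul_sum, Finset.mul_sum]
    refine Finset.sum_congr rfl fun i _ => ?_
    ring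
  rw [h2, h3] at h1
  rw [← h1]
  ring

lemma resolvent_diag_ne_zero (j : Fin N) : resolvent H z j j ≠ 0 :=
  left_ne_zero_of_mul (by rw [schur hH hz j]; exact one_ne_zero)

/-- Removing a row and a column perturbs the other diagonal resolvent entries by a rank one
term. -/
lemma resolvent_minor_diag {j k : Fin N} (hk : k ≠ j) :
    resolvent H z k k = resolvent (minor H j) z k k
      + resolvent H z k j * resolvent H z j k / resolvent H z j j := by
  have h := congrFun (off_solution hH hz j (resolvent_col_eq hH hz k)) k
  rw [if_neg hk] at h
  have h0 := resolvent_diag_ne_zero hH hz j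
  have h1 := resolvent_off_col hH hz j k
  rw [if_neg hk] at h1
  have h2 : (fun l => if l = j then 0 else (if l = k then 1 else 0)
      - resolvent H z j k * offCol H j l)
      = (Pi.single k 1 : Fin N → ℂ) - resolvent H z j k • offCol H j := by
    funext l
    by_cases hl : l = j
    · subst hl; simp [offCol, hk.symm]
    · simp [hl, Pi.single_apply]
  rw [h2, mulVec_sub, mulVec_smul, mulVec_single_one] at h
  simp only [Pi.sub_apply, Pi.smul_apply, smul_eq_mul, col_apply] at h
  rw [h1, h]
  field_simp
  ring

/-- Removing a row and a column changes the trace of the resolvent by at most `1 / Im z`. -/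
lemma norm_trace_sub_offTrace_le (j : Fin N) :
    ‖(resolvent H z).trace - offTrace (resolvent (minor H j) z) j‖ ≤ 1 / z.im := by
  set G := resolvent H z with hG
  have h0 : G j j ≠ 0 := resolvent_diag_ne_zero hH hz j
  have h1 : G.trace - offTrace (resolvent (minor H j) z) j
      = (∑ k, G k j * G j k) / G j j := by
    rw [Matrix.trace, offTrace, ← Finset.sum_sub_distrib, Finset.sum_div]
    refine Finset.sum_congr rfl fun k _ => ?_
    by_cases hk : k = j
    · subst hk
      simp [h0]
    · rw [if_neg hk, diag_apply, hG, resolvent_minor_diag hH hz hk]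
      ring
  have h2 : ‖∑ k, G k j * G j k‖ ≤ (G j j).im / z.im := by
    have hc := ward_col hH hz j
    have hr := ward_row hH hz j
    calc ‖∑ k, G k j * G j k‖ ≤ ∑ k, ‖G k j‖ * ‖G j k‖ := by
          refine (norm_sum_le _ _).trans (le_of_eq ?_); simp
      _ ≤ ∑ k, (Complex.normSq (G k j) + Complex.normSq (G j k)) / 2 := by
          refine Finset.sum_le_sum fun k _ => ?_
          rw [Complex.normSq_eq_norm_sq, Complex.normSq_eq_norm_sq]
          nlinarith [sq_nonneg (‖G k j‖ - ‖G j k‖)]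
      _ = (G j j).im / z.im := by
          rw [← Finset.sum_div, Finset.sum_add_distrib, eq_div_iff hz.ne']
          linarith
  rw [h1, norm_div, div_le_iff₀ (norm_pos_iff.mpr h0)]
  calc _ ≤ (G j j).im / z.im := h2
    _ ≤ ‖G j j‖ / z.im := by
        gcongr
        exact (le_abs_self _).trans (Complex.abs_im_le_norm _)
    _ = _ := by ring

/-- The Hilbert-Schmidt norm of the resolvent in terms of its trace. -/
lemma sum_normSq_resolvent :
    ∑ k, ∑ l, Complex.normSq (resolvent H z k l) = (resolvent H z).trace.im / z.im := by
  rw [eq_div_iff hz.ne', Matrix.trace, Complex.im_sum, mul_comm, Finset.mul_sum]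
  exact Finset.sum_congr rfl fun k _ => ward_row hH hz k

lemma norm_trace_resolvent_le : ‖(resolvent H z).trace‖ ≤ N / z.im := by
  calc _ ≤ ∑ k, ‖resolvent H z k k‖ := norm_sum_le _ _
    _ ≤ ∑ _k : Fin N, 1 / z.im := Finset.sum_le_sum fun k _ => norm_resolvent_diag_le hH hz k
    _ = _ := by simp [div_eq_mul_inv]

end Schur

/-! ### The self-consistent equation and induction on scales -/

/-- The normalized trace `N⁻¹ Tr (H - z)⁻¹` of the resolvent. -/
noncomputable def stieltjes (H : Matrix (Fin N) (Fin N) ℂ) (z : ℂ) : ℂ :=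
  (resolvent H z).trace / N

/-- Stability of the equation `m = -1 / (z + m)` in the bulk: an approximate solution in the upper
half-plane is bounded and has imaginary part bounded from below. The discriminant `z ^ 2 - 4` has
negative real part, which keeps `2 m + z` away from the real axis. -/
lemma stability {E η c₀ ε : ℝ} {m : ℂ} (hc₀ : 0 < c₀) (hE : 8 * c₀ ^ 2 = 4 - E ^ 2)
    (hη : 0 < η) (hη1 : η ≤ 1) (hm : 0 ≤ m.im) (hε : 7 * ε ≤ c₀ ^ 2)
    (h : ‖m + 1 / (⟨E, η⟩ + m)‖ ≤ ε) :
    c₀ ≤ η + m.im ∧ ‖m‖ ≤ 4 := by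
  set z : ℂ := ⟨E, η⟩ with hz
  have hzm : z + m ≠ 0 := by
    intro h0
    have := congrArg Complex.im h0
    simp [hz] at this
    linarith
  have hE4 : E ^ 2 ≤ 4 := by nlinarith [sq_nonneg c₀]
  have hε2 : ε ≤ 1 / 14 := by nlinarith [sq_nonneg E]
  have hε0 : 0 ≤ ε := (norm_nonneg _).trans h
  have hz3 : ‖z‖ ≤ 3 := by
    refine le_of_sq_le_sq ?_ (by norm_num)
    rw [← Complex.normSq_eq_norm_sq, Complex.normSq_apply]
    simp only [hz]
    nlinarith
  have hpos : 0 < ‖z + m‖ := norm_pos_iff.mpr hzm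
  have herr : ‖m * (z + m) + 1‖ ≤ ε * ‖z + m‖ := by
    have : m * (z + m) + 1 = (m + 1 / (z + m)) * (z + m) := by field_simp
    rw [this, norm_mul]
    gcongr
  have hm4 : ‖m‖ ≤ 4 := by
    by_contra! hlt
    have h1 : ‖m‖ ≤ ‖z + m‖ + ‖z‖ := by
      simpa using norm_sub_le (z + m) z
    have h2 : ‖m‖ * ‖z + m‖ ≤ ε * ‖z + m‖ + 1 := by
      have := norm_sub_le (m * (z + m) + 1) 1
      rw [add_sub_cancel_right, norm_mul, norm_one] at this
      linarith
    nlinarith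
  refine ⟨?_, hm4⟩
  set e := m * (z + m) + 1 with he
  have hzm7 : ‖z + m‖ ≤ 7 := (norm_add_le _ _).trans (by linarith)
  have hre : e.re ≤ 7 * ε := by
    calc e.re ≤ ‖e‖ := Complex.re_le_norm e
      _ ≤ ε * ‖z + m‖ := herr
      _ ≤ 7 * ε := by nlinarith
  have hee : e.re = m.re * (E + m.re) - m.im * (η + m.im) + 1 := by
    simp [he, hz]
  have hsq : (2 * c₀) ^ 2 ≤ (η + 2 * m.im) ^ 2 := by
    rw [hee] at hre
    nlinarith [sq_nonneg (2 * m.re + E)]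
  have := le_of_sq_le_sq hsq (by positivity)
  linarith

/-- The trace of the resolvent is in the range predicted by the self-consistent equation. -/
def IsRegular (c₀ : ℝ) (H : Matrix (Fin N) (Fin N) ℂ) (z : ℂ) : Prop :=
  c₀ ≤ z.im + (stieltjes H z).im ∧ ‖stieltjes H z‖ ≤ 4

/-- The diagonal entry or the quadratic form in the Schur complement formula for row `j` deviates by
at least `δ` from its mean. The condition on the resolvent of the minor bounds its Hilbert-Schmidt
norm, so that this event has small probability conditionally on the minor. It holds automatically
when the trace of the full resolvent is under control. -/
def IsBadRow (δ : ℝ) (H : Matrix (Fin N) (Fin N) ℂ) (z : ℂ) (j : Fin N) : Prop :=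
  (resolvent (minor H j) z).trace.im ≤ 9 * N ∧
    (δ ≤ ‖H j j‖ ∨ δ ≤ ‖quadForm (resolvent (minor H j) z) (offCol H j)
      - offTrace (resolvent (minor H j) z) j / N‖)

section Deterministic

variable {H : Matrix (Fin N) (Fin N) ℂ} (hH : H.IsHermitian)
include hH

lemma stieltjes_im_nonneg {z : ℂ} (hz : 0 < z.im) : 0 ≤ (stieltjes H z).im := by
  rw [stieltjes, Complex.div_natCast_im, Matrix.trace, Complex.im_sum]
  exact div_nonneg (Finset.sum_nonneg fun j _ => resolvent_im_nonneg hH hz j) (Nat.cast_nonneg _)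

lemma stieltjes_half_scale {E η : ℝ} (hη : 0 < η) :
    (stieltjes H ⟨E, η / 2⟩).im ≤ 2 * (stieltjes H ⟨E, η⟩).im ∧
    (stieltjes H ⟨E, η⟩).im ≤ 2 * (stieltjes H ⟨E, η / 2⟩).im := by
  simp only [stieltjes, Complex.div_natCast_im, Matrix.trace, Complex.im_sum, ← mul_div_assoc,
    Finset.mul_sum]
  constructor <;> refine div_le_div_of_nonneg_right (Finset.sum_le_sum fun j _ => ?_)
    (Nat.cast_nonneg _)
  · exact (resolvent_half_scale hH hη j).2.1
  · exact (resolvent_half_scale hH hη j).2.2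

/-- If the trace is under control at scale `η`, then at scale `η / 2` every row that is not bad
obeys the self-consistent equation up to a small error. -/
lemma good_row {E η c₀ δ : ℝ} (hη : 0 < η) (hc₀ : 0 < c₀) (hδ : 0 < δ)
    (hδc : 12 * δ ≤ c₀) (hNδ : 1 ≤ δ * (N * (η / 2))) (hN2 : 2 ≤ N * (η / 2))
    (hreg : IsRegular c₀ H ⟨E, η⟩) {j : Fin N} (hj : ¬ IsBadRow δ H ⟨E, η / 2⟩ j) :
    ‖resolvent H ⟨E, η / 2⟩ j j‖ ≤ 4 / c₀ ∧
    ‖resolvent H ⟨E, η / 2⟩ j j + 1 / (⟨E, η / 2⟩ + stieltjes H ⟨E, η / 2⟩)‖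
      ≤ 24 * δ / c₀ ^ 2 := by
  set z : ℂ := ⟨E, η / 2⟩ with hz
  have hzim : z.im = η / 2 := rfl
  have hzpos : 0 < z.im := by rw [hzim]; positivity
  set m := stieltjes H z with hm
  set G := resolvent H z with hG
  set G' := resolvent (minor H j) z with hG'
  have hN : (0 : ℝ) < N := by
    by_contra! h0
    have : (N : ℝ) * (η / 2) ≤ 0 := mul_nonpos_of_nonpos_of_nonneg h0 (by positivity)
    linarith
  have hNne : (N : ℂ) ≠ 0 := by exact_mod_cast hN.ne'
  obtain ⟨s1, s2⟩ := stieltjes_half_scale hH (E := E) hη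
  rw [← hz, ← hm] at s1 s2
  obtain ⟨r1, r2⟩ := hreg
  simp only at r1
  have hlow : c₀ / 2 ≤ η / 2 + m.im := by linarith
  have hup : m.im ≤ 8 := by
    have : (stieltjes H ⟨E, η⟩).im ≤ 4 := (Complex.im_le_norm _).trans r2
    linarith
  have htr : ‖G.trace - offTrace G' j‖ ≤ 1 / (η / 2) := norm_trace_sub_offTrace_le hH hzpos j
  have htrm : G.trace = N * m := by rw [hm, stieltjes, mul_div_cancel₀ _ hNne]
  -- the hypothesis on the minor in the definition of a bad row holds automatically
  have hminor : G'.trace.im ≤ 9 * N := by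
    have h1 : G'.trace = offTrace G' j + G' j j := by
      rw [Matrix.trace, offTrace, ← Finset.add_sum_erase _ _ (Finset.mem_univ j),
        ← Finset.add_sum_erase Finset.univ (fun k => if k = j then 0 else G' k k)
        (Finset.mem_univ j), if_pos rfl, zero_add, add_comm, diag_apply]
      congr 1
      exact Finset.sum_congr rfl fun k hk => by rw [if_neg (Finset.ne_of_mem_erase hk), diag_apply]
    have h2 : (G' j j).im ≤ 1 / (η / 2) :=
      (Complex.im_le_norm _).trans (norm_resolvent_diag_le (isHermitian_minor hH j) hzpos j)
    have h3 : (offTrace G' j).im ≤ G.trace.im + 1 / (η / 2) := by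
      have := (Complex.abs_im_le_norm (G.trace - offTrace G' j)).trans htr
      rw [Complex.sub_im] at this
      linarith [neg_le_of_abs_le this]
    have h4 : G.trace.im ≤ N * 8 := by
      rw [htrm, ← Complex.ofReal_natCast, Complex.im_ofReal_mul]
      gcongr
    have h5 : 1 / (η / 2) ≤ N / 2 := by
      rw [div_le_div_iff₀ (by positivity) (by norm_num)]
      linarith
    rw [h1, Complex.add_im]
    linarith
  have hj' : ‖H j j‖ < δ ∧ ‖quadForm G' (offCol H j) - offTrace G' j / N‖ < δ := by
    unfold IsBadRow at hj
    push Not at hj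
    exact hj hminor
  have hm' : ‖m - offTrace G' j / N‖ ≤ δ := by
    have : m - offTrace G' j / N = (G.trace - offTrace G' j) / N := by
      rw [htrm]; field_simp
    rw [this, norm_div, Complex.norm_natCast, div_le_iff₀ hN]
    refine htr.trans ?_
    rw [div_le_iff₀ (by positivity)]
    linarith
  set x : ℂ := H j j - quadForm G' (offCol H j) + m with hx
  have hxle : ‖x‖ ≤ 3 * δ := by
    have : x = H j j - (quadForm G' (offCol H j) - offTrace G' j / N)
        + (m - offTrace G' j / N) := by rw [hx]; ring
    rw [this]
    refine (norm_add_le _ _).trans ?_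
    have := norm_sub_le (H j j) (quadForm G' (offCol H j) - offTrace G' j / N)
    linarith [hj'.1, hj'.2]
  have hschur : G j j * (x - (z + m)) = 1 := by
    rw [← schur hH hzpos j, hx]
    ring
  have hzm : c₀ / 2 ≤ ‖z + m‖ := by
    refine hlow.trans ?_
    have := Complex.im_le_norm (z + m)
    rwa [Complex.add_im, hzim] at this
  have hzmne : z + m ≠ 0 := norm_pos_iff.mp (by linarith)
  have hGle : ‖G j j‖ ≤ 4 / c₀ := by
    have h1 : c₀ / 4 ≤ ‖x - (z + m)‖ := by
      have := norm_sub_le x (x - (z + m))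
      rw [sub_sub_cancel] at this
      linarith
    have h2 : ‖G j j‖ * ‖x - (z + m)‖ = 1 := by rw [← norm_mul, hschur, norm_one]
    rw [le_div_iff₀ hc₀]
    nlinarith [norm_nonneg (G j j)]
  refine ⟨hGle, ?_⟩
  have h3 : G j j + 1 / (z + m) = G j j * x / (z + m) := by
    field_simp
    linear_combination -hschur
  rw [h3, norm_div, norm_mul, div_le_iff₀ (by linarith)]
  calc ‖G j j‖ * ‖x‖ ≤ 4 / c₀ * (3 * δ) := by gcongr
    _ = 24 * δ / c₀ ^ 2 * (c₀ / 2) := by field_simp; ring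
    _ ≤ _ := by gcongr

end Deterministic

open Classical in
/-- A weighted count of the scales `1, …, k` at which a row is bad. It dominates the growth of the
diagonal resolvent entry, which at most doubles from one scale to the next. -/
noncomputable def overflow (C : ℝ) (b : ℕ → Prop) (k : ℕ) : ℝ :=
  ∑ l ∈ Finset.range k, 2 ^ (k - l) * C * (if b (l + 1) then 1 else 0)

open Classical in
lemma overflow_succ (C : ℝ) (b : ℕ → Prop) (k : ℕ) :
    overflow C b (k + 1) = 2 * overflow C b k + 2 * C * (if b (k + 1) then 1 else 0) := by
  rw [overflow, Finset.sum_range_succ, overflow, Finset.mul_sum]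
  congr 1
  · refine Finset.sum_congr rfl fun l hl => ?_
    rw [Nat.succ_sub (Finset.mem_range.mp hl).le, pow_succ]
    ring
  · simp

lemma overflow_nonneg {C : ℝ} (hC : 0 ≤ C) (b : ℕ → Prop) (k : ℕ) : 0 ≤ overflow C b k := by
  refine Finset.sum_nonneg fun l _ => ?_
  split_ifs <;> positivity

/-- The spectral parameter `E + 2⁻ᵏ i`. -/
noncomputable def scalePt (E : ℝ) (k : ℕ) : ℂ := ⟨E, 1 / 2 ^ k⟩

lemma scalePt_im (E : ℝ) (k : ℕ) : (scalePt E k).im = 1 / 2 ^ k := rfl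

lemma scalePt_im_pos (E : ℝ) (k : ℕ) : 0 < (scalePt E k).im := by
  rw [scalePt_im]; positivity

lemma scalePt_succ (E : ℝ) (k : ℕ) : scalePt E (k + 1) = ⟨E, (1 / 2 ^ k) / 2⟩ := by
  rw [scalePt, pow_succ, div_div]

section Bootstrap

variable {H : Matrix (Fin N) (Fin N) ℂ} (hH : H.IsHermitian)
include hH

/-- One step of the induction on scales. Good rows obey the self-consistent equation; on a bad row
the resolvent entry at most doubles, which the overflow accounts for. If the overflow is small on
average over the rows, the averaged equation still holds approximately and stability applies. -/
lemma regular_step {E c₀ δ : ℝ} (hc₀ : 0 < c₀) (hE : 8 * c₀ ^ 2 = 4 - E ^ 2) (hδ : 0 < δ)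
    (hδc : 336 * δ ≤ c₀ ^ 4) {k : ℕ} (hNδ : 1 ≤ δ * (N / 2 ^ (k + 1)))
    (hreg : IsRegular c₀ H (scalePt E k))
    (hG : ∀ j, ‖resolvent H (scalePt E k) j j‖
      ≤ 4 / c₀ + overflow (4 / c₀) (fun l => IsBadRow δ H (scalePt E l) j) k) :
    (∀ j, ¬ IsBadRow δ H (scalePt E (k + 1)) j → ‖resolvent H (scalePt E (k + 1)) j j‖ ≤ 4 / c₀) ∧
    (∀ j, ‖resolvent H (scalePt E (k + 1)) j j‖
      ≤ 4 / c₀ + overflow (4 / c₀) (fun l => IsBadRow δ H (scalePt E l) j) (k + 1)) ∧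
    ((∑ j, overflow (4 / c₀) (fun l => IsBadRow δ H (scalePt E l) j) (k + 1)) / N
        ≤ c₀ ^ 2 / 28 → IsRegular c₀ H (scalePt E (k + 1))) := by
  have hcsq : c₀ ^ 2 ≤ 1 / 2 := by nlinarith [sq_nonneg E]
  have hc1 : c₀ ≤ 1 := by nlinarith
  have hC : 0 < 4 / c₀ := by positivity
  have hη : (0 : ℝ) < 1 / 2 ^ k := by positivity
  have hδ12 : 12 * δ ≤ c₀ := by
    have : c₀ ^ 4 ≤ c₀ := by
      calc c₀ ^ 4 ≤ c₀ ^ 1 := pow_le_pow_of_le_one hc₀.le hc1 (by norm_num)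
        _ = c₀ := pow_one _
    linarith
  have hδ2 : δ ≤ 1 / 2 := by linarith
  have hNe : (N : ℝ) * (1 / 2 ^ k / 2) = N / 2 ^ (k + 1) := by rw [pow_succ]; field_simp
  have hN2 : 2 ≤ (N : ℝ) / 2 ^ (k + 1) := by
    have : 0 ≤ (N : ℝ) / 2 ^ (k + 1) := by positivity
    nlinarith
  have hN : (0 : ℝ) < N := by
    by_contra! h0
    have : (N : ℝ) / 2 ^ (k + 1) ≤ 0 := div_nonpos_of_nonpos_of_nonneg h0 (by positivity)
    linarith
  have good := fun (j : Fin N) (hj : ¬ IsBadRow δ H (scalePt E (k + 1)) j) =>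
    good_row hH (E := E) hη hc₀ hδ hδ12 (by rwa [hNe]) (by rwa [hNe]) hreg
      (j := j) (by rwa [← scalePt_succ])
  simp only [← scalePt_succ] at good
  -- the growth on bad rows is absorbed by the recursion for the overflow
  set b : Fin N → ℕ → Prop := fun j l => IsBadRow δ H (scalePt E l) j with hb
  have hnn : ∀ j k, 0 ≤ overflow (4 / c₀) (b j) k := fun j k => overflow_nonneg hC.le _ _
  have hall : ∀ j, ‖resolvent H (scalePt E (k + 1)) j j‖
      ≤ 4 / c₀ + overflow (4 / c₀) (b j) (k + 1) := by
    intro j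
    by_cases hj : IsBadRow δ H (scalePt E (k + 1)) j
    · have h1 := (resolvent_half_scale hH (E := E) hη j).1
      rw [← scalePt_succ] at h1
      have h2 : ‖resolvent H (scalePt E (k + 1)) j j‖ ≤ 2 * ‖resolvent H (scalePt E k) j j‖ := h1
      rw [overflow_succ, if_pos hj]
      have := hG j
      linarith
    · have := (good j hj).1
      linarith [hnn j (k + 1)]
  refine ⟨fun j hj => (good j hj).1, hall, fun hsum => ?_⟩
  set z := scalePt E (k + 1) with hz
  set m := stieltjes H z with hm
  have hzpos : 0 < z.im := scalePt_im_pos _ _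
  have hmim : 0 ≤ m.im := stieltjes_im_nonneg hH hzpos
  have hrow : ∀ j, ‖resolvent H z j j + 1 / (z + m)‖
      ≤ 24 * δ / c₀ ^ 2 + 2 * overflow (4 / c₀) (b j) (k + 1) := by
    intro j
    by_cases hj : IsBadRow δ H z j
    · have h1 : c₀ / 2 ≤ ‖z + m‖ := by
        have h2 := (stieltjes_half_scale hH (E := E) hη).2
        rw [← scalePt_succ] at h2
        have h3 : c₀ ≤ 1 / 2 ^ k + (stieltjes H ⟨E, 1 / 2 ^ k⟩).im := hreg.1
        have h4 := Complex.im_le_norm (z + m)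
        rw [Complex.add_im, hz, scalePt_im, pow_succ, ← div_div] at h4
        linarith
      have h5 : ‖1 / (z + m)‖ ≤ 2 / c₀ := by
        rw [norm_div, norm_one, div_le_div_iff₀ (by linarith) hc₀]
        linarith
      have h6 : 2 * (4 / c₀) ≤ overflow (4 / c₀) (b j) (k + 1) := by
        rw [overflow_succ, if_pos hj]
        linarith [hnn j k]
      have h7 : 2 / c₀ ≤ 4 / c₀ := by gcongr; norm_num
      have h8 : 0 ≤ 24 * δ / c₀ ^ 2 := by positivity
      have := (norm_add_le (resolvent H z j j) (1 / (z + m))).trans (add_le_add (hall j) h5)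
      linarith
    · exact (good j hj).2.trans (by linarith [hnn j (k + 1)])
  have hNne : (N : ℂ) ≠ 0 := by exact_mod_cast hN.ne'
  have hself : ‖m + 1 / (z + m)‖ ≤ c₀ ^ 2 / 7 := by
    have h1 : m + 1 / (z + m) = (∑ j, (resolvent H z j j + 1 / (z + m))) / N := by
      rw [Finset.sum_add_distrib, Finset.sum_const, Finset.card_univ, Fintype.card_fin,
        nsmul_eq_mul, add_div, mul_div_cancel_left₀ _ hNne]
      rfl
    rw [h1, norm_div, Complex.norm_natCast, div_le_iff₀ hN]
    refine (norm_sum_le _ _).trans ((Finset.sum_le_sum fun j _ => hrow j).trans ?_)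
    rw [Finset.sum_add_distrib, Finset.sum_const, Finset.card_univ, Fintype.card_fin,
        nsmul_eq_mul, ← Finset.mul_sum]
    rw [div_le_iff₀ hN] at hsum
    have h2 : 24 * δ / c₀ ^ 2 ≤ c₀ ^ 2 / 14 := by
      rw [div_le_div_iff₀ (by positivity) (by norm_num)]
      nlinarith
    nlinarith
  have hzle : z.im ≤ 1 := by
    rw [hz, scalePt_im]
    exact div_le_one_of_le₀ (one_le_pow₀ (by norm_num)) (by positivity)
  exact stability (E := E) (η := z.im) hc₀ hE hzpos hzle hmim (by linarith) hself

/-- At scale one the resolvent is bounded for trivial reasons. -/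
lemma regular_zero {E c₀ : ℝ} (hc1 : c₀ ≤ 1) : IsRegular c₀ H (scalePt E 0) := by
  have hz : (scalePt E 0).im = 1 := by simp [scalePt_im]
  have hpos := scalePt_im_pos E 0
  refine ⟨?_, ?_⟩
  · have := stieltjes_im_nonneg hH hpos
    rw [hz]; linarith
  · have h1 := norm_trace_resolvent_le hH hpos
    rw [stieltjes, norm_div, Complex.norm_natCast]
    rw [hz, div_one] at h1
    exact (div_le_one_of_le₀ h1 (Nat.cast_nonneg _)).trans (by norm_num)

/-- Induction on scales: if the overflow is small on average at all scales up to `k`, then the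
diagonal resolvent entries of the rows that are not bad at scale `k` are bounded. -/
lemma norm_resolvent_le_of_overflow_le {E c₀ δ : ℝ} (hc₀ : 0 < c₀) (hE : 8 * c₀ ^ 2 = 4 - E ^ 2)
    (hδ : 0 < δ) (hδc : 336 * δ ≤ c₀ ^ 4) {k : ℕ} (hNδ : 1 ≤ δ * (N / 2 ^ k))
    (hsum : ∀ l, l < k →
      (∑ j, overflow (4 / c₀) (fun l => IsBadRow δ H (scalePt E l) j) l) / N ≤ c₀ ^ 2 / 28)
    {j : Fin N} (hj : ¬ IsBadRow δ H (scalePt E k) j) :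
    ‖resolvent H (scalePt E k) j j‖ ≤ 4 / c₀ := by
  have hcsq : c₀ ^ 2 ≤ 1 / 2 := by nlinarith [sq_nonneg E]
  have hc1 : c₀ ≤ 1 := by nlinarith
  have h41 : 1 ≤ 4 / c₀ := by rw [le_div_iff₀ hc₀]; linarith
  have hzero : ∀ j, ‖resolvent H (scalePt E 0) j j‖ ≤ 1 := fun j => by
    have := norm_resolvent_diag_le hH (scalePt_im_pos E 0) j
    simpa [scalePt_im] using this
  have hscale : ∀ l, l ≤ k → 1 ≤ δ * (N / 2 ^ l) := fun l hl => by
    refine hNδ.trans ?_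
    gcongr
    norm_num
  have hind : ∀ l, l < k → IsRegular c₀ H (scalePt E l) ∧
      ∀ j, ‖resolvent H (scalePt E l) j j‖
      ≤ 4 / c₀ + overflow (4 / c₀) (fun l => IsBadRow δ H (scalePt E l) j) l := by
    intro l
    induction l with
    | zero =>
      intro _
      refine ⟨regular_zero hH hc1, fun j => ?_⟩
      have := hzero j
      simp only [overflow, Finset.range_zero, Finset.sum_empty]
      linarith
    | succ l ih =>
      intro hl
      obtain ⟨h1, h2⟩ := ih (by omega)
      obtain ⟨-, h3, h4⟩ := regular_step hH hc₀ hE hδ hδc (hscale (l + 1) hl.le) h1 h2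
      exact ⟨h4 (hsum _ hl), h3⟩
  rcases k with _ | k
  · exact (hzero j).trans h41
  · obtain ⟨h1, h2⟩ := hind k (by omega)
    exact (regular_step hH hc₀ hE hδ hδc hNδ h1 h2).1 j hj

end Bootstrap

end WignerDeloc

namespace WignerDeloc

open Finset

/-! ### Concentration of quadratic forms -/

lemma exp_le_one_add_add (y : ℝ) : Real.exp y ≤ 1 + y + y ^ 2 * Real.exp |y| := by
  have h := Complex.norm_exp_sub_sum_le_norm_mul_exp (y : ℂ) 2
  simp only [Finset.sum_range_succ, Finset.sum_range_zero] at h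
  have h1 : Complex.exp (y : ℂ) - (0 + (y : ℂ) ^ 0 / (Nat.factorial 0 : ℂ)
      + (y : ℂ) ^ 1 / (Nat.factorial 1 : ℂ)) = ((Real.exp y - (1 + y) : ℝ) : ℂ) := by
    push_cast
    simp
  rw [h1, Complex.norm_real, Complex.norm_real, Real.norm_eq_abs, Real.norm_eq_abs, sq_abs] at h
  linarith [le_of_abs_le h]

/-- A centered random variable with an exponential moment has a sub-Gaussian moment generating
function near the origin. -/
lemma lintegral_exp_le_of_centered {α : Type*} [MeasurableSpace α] {μ : Measure α}
    [IsProbabilityMeasure μ] {X : α → ℝ} (hX : Measurable X) {a : ℝ} (ha : 0 < a)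
    (hint : Integrable (fun x => Real.exp (2 * a * |X x|)) μ) (h0 : ∫ x, X x ∂μ = 0) :
    ∃ K : ℝ, 0 < K ∧ ∀ t : ℝ, |t| ≤ a →
      ∫⁻ x, ENNReal.ofReal (Real.exp (t * X x)) ∂μ ≤ ENNReal.ofReal (Real.exp (K * t ^ 2)) := by
  have hsq : ∀ u : ℝ, 0 ≤ u → u ^ 2 ≤ 2 / a ^ 2 * Real.exp (a * u) := by
    intro u hu
    have := Real.quadratic_le_exp_of_nonneg (mul_nonneg ha.le hu)
    have h2 : a ^ 2 * u ^ 2 ≤ 2 * Real.exp (a * u) := by nlinarith [mul_nonneg ha.le hu]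
    rw [div_mul_eq_mul_div, le_div_iff₀ (by positivity)]
    linarith
  have hXi : Integrable X μ := by
    refine (hint.const_mul (1 / a)).mono' hX.aestronglyMeasurable (ae_of_all _ fun x => ?_)
    rw [Real.norm_eq_abs]
    have := Real.add_one_le_exp (2 * a * |X x|)
    rw [div_mul_eq_mul_div, le_div_iff₀ ha]
    nlinarith [mul_nonneg ha.le (abs_nonneg (X x))]
  set I := ∫ x, Real.exp (2 * a * |X x|) ∂μ with hI
  have hIpos : 0 ≤ I := integral_nonneg fun x => (Real.exp_pos _).le
  refine ⟨2 / a ^ 2 * I + 1, by positivity, fun t ht => ?_⟩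
  have hbound : ∀ x, Real.exp (t * X x)
      ≤ 1 + t * X x + t ^ 2 * (2 / a ^ 2 * Real.exp (2 * a * |X x|)) := by
    intro x
    have h1 := hsq |X x| (abs_nonneg _)
    rw [sq_abs] at h1
    refine (exp_le_one_add_add _).trans (add_le_add le_rfl ?_)
    rw [mul_pow, mul_assoc]
    refine mul_le_mul_of_nonneg_left ?_ (sq_nonneg t)
    calc X x ^ 2 * Real.exp |t * X x|
        ≤ (2 / a ^ 2 * Real.exp (a * |X x|)) * Real.exp (a * |X x|) := by
          gcongr
          rw [abs_mul]
          gcongr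
      _ = _ := by
          rw [mul_assoc, ← Real.exp_add]
          ring_nf
  have hg : Integrable (fun x => 1 + t * X x + t ^ 2 * (2 / a ^ 2 * Real.exp (2 * a * |X x|))) μ :=
    ((integrable_const _).add (hXi.const_mul _)).add ((hint.const_mul _).const_mul _)
  calc ∫⁻ x, ENNReal.ofReal (Real.exp (t * X x)) ∂μ
      ≤ ∫⁻ x, ENNReal.ofReal (1 + t * X x + t ^ 2 * (2 / a ^ 2 * Real.exp (2 * a * |X x|))) ∂μ :=
        lintegral_mono fun x => ENNReal.ofReal_le_ofReal (hbound x)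
    _ = ENNReal.ofReal (∫ x, (1 + t * X x
          + t ^ 2 * (2 / a ^ 2 * Real.exp (2 * a * |X x|))) ∂μ) :=
        (ofReal_integral_eq_lintegral_ofReal hg
          (ae_of_all _ fun x => (Real.exp_pos _).le.trans (hbound x))).symm
    _ ≤ _ := by
        apply ENNReal.ofReal_le_ofReal
        rw [integral_add (f := fun x => 1 + t * X x) ((integrable_const _).add (hXi.const_mul _))
          ((hint.const_mul _).const_mul _), integral_add (integrable_const _) (hXi.const_mul _),
          integral_const_mul, integral_const_mul, integral_const_mul, h0, ← hI]
        simp only [integral_const, probReal_univ, smul_eq_mul]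
        have := Real.add_one_le_exp ((2 / a ^ 2 * I + 1) * t ^ 2)
        nlinarith [sq_nonneg t]

/-- A law is `v`-sub-Gaussian if its moment generating function is at most `exp (v t²)`. -/
def IsSubgaussianLaw (ν : Measure ℝ) (v : ℝ) : Prop :=
  ∀ t : ℝ, ∫⁻ x, ENNReal.ofReal (Real.exp (t * x)) ∂ν ≤ ENNReal.ofReal (Real.exp (v * t ^ 2))

section Law

variable {ν : Measure ℝ} [IsProbabilityMeasure ν] {δ₀ : ℝ} (hδ₀ : 0 < δ₀)
  (hint : Integrable (fun x : ℝ => Real.exp (δ₀ * x ^ 2)) ν)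
include hδ₀ hint

lemma exists_isSubgaussianLaw (h0 : ∫ x, x ∂ν = 0) : ∃ v : ℝ, 0 < v ∧ IsSubgaussianLaw ν v := by
  have hint1 : Integrable (fun x : ℝ => Real.exp (2 * 1 * |x|)) ν := by
    refine (hint.const_mul (Real.exp (1 / δ₀))).mono' (by fun_prop) (ae_of_all _ fun x => ?_)
    rw [Real.norm_of_nonneg (Real.exp_pos _).le, ← Real.exp_add, Real.exp_le_exp]
    have h1 : 1 / δ₀ + δ₀ * x ^ 2 - 2 * |x| = (δ₀ * |x| - 1) ^ 2 / δ₀ := by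
      rw [← sq_abs x]; field_simp; ring
    have h2 : 0 ≤ (δ₀ * |x| - 1) ^ 2 / δ₀ := by positivity
    linarith
  obtain ⟨K, hK, hKt⟩ := lintegral_exp_le_of_centered measurable_id one_pos hint1 h0
  simp only [id] at hKt
  set D := ∫ x, Real.exp (δ₀ * x ^ 2) ∂ν with hD
  have hDpos : 0 ≤ D := integral_nonneg fun x => (Real.exp_pos _).le
  refine ⟨K + (D + 1 / (4 * δ₀)), by positivity, fun t => ?_⟩
  -- centering gives the bound for small `t`; for large `t` one uses `t x ≤ t² / (4 δ₀) + δ₀ x²`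
  by_cases ht : |t| ≤ 1
  · refine (hKt t ht).trans (ENNReal.ofReal_le_ofReal (Real.exp_le_exp.mpr ?_))
    have : 0 ≤ (D + 1 / (4 * δ₀)) * t ^ 2 := by positivity
    linarith
  · have ht1 : 1 ≤ t ^ 2 := by
      rw [← sq_abs]; nlinarith
    calc ∫⁻ x, ENNReal.ofReal (Real.exp (t * x)) ∂ν
        ≤ ∫⁻ x, ENNReal.ofReal (Real.exp (t ^ 2 / (4 * δ₀)) * Real.exp (δ₀ * x ^ 2)) ∂ν := by
          refine lintegral_mono fun x => ENNReal.ofReal_le_ofReal ?_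
          rw [← Real.exp_add, Real.exp_le_exp]
          have : t ^ 2 / (4 * δ₀) + δ₀ * x ^ 2 - t * x = (t - 2 * δ₀ * x) ^ 2 / (4 * δ₀) := by
            field_simp; ring
          have h2 : 0 ≤ (t - 2 * δ₀ * x) ^ 2 / (4 * δ₀) := by positivity
          linarith
      _ = ENNReal.ofReal (Real.exp (t ^ 2 / (4 * δ₀)) * D) := by
          rw [← ofReal_integral_eq_lintegral_ofReal (hint.const_mul _)
            (ae_of_all _ fun x => by positivity), integral_const_mul]
      _ ≤ _ := by
          apply ENNReal.ofReal_le_ofReal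
          have h1 : D ≤ Real.exp (D * t ^ 2) := by
            have := Real.add_one_le_exp (D * t ^ 2)
            nlinarith
          calc Real.exp (t ^ 2 / (4 * δ₀)) * D
              ≤ Real.exp (t ^ 2 / (4 * δ₀)) * Real.exp (D * t ^ 2) := by gcongr
            _ ≤ _ := by
                rw [← Real.exp_add, Real.exp_le_exp]
                have : t ^ 2 / (4 * δ₀) = 1 / (4 * δ₀) * t ^ 2 := by ring
                rw [this]
                nlinarith

lemma exists_lintegral_exp_sq_sub_le {s : ℝ} (h0 : ∫ x, x ^ 2 ∂ν = s) :
    ∃ D β : ℝ, 0 < D ∧ 0 < β ∧ ∀ b : ℝ, |b| ≤ β →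
      ∫⁻ x, ENNReal.ofReal (Real.exp (b * (x ^ 2 - s))) ∂ν
        ≤ ENNReal.ofReal (Real.exp (D * b ^ 2)) := by
  have hint1 : Integrable (fun x : ℝ => Real.exp (2 * (δ₀ / 2) * |x ^ 2 - s|)) ν := by
    refine (hint.const_mul (Real.exp (δ₀ * |s|))).mono' (by fun_prop) (ae_of_all _ fun x => ?_)
    rw [Real.norm_of_nonneg (Real.exp_pos _).le, ← Real.exp_add, Real.exp_le_exp]
    have h1 : |x ^ 2 - s| ≤ x ^ 2 + |s| := by
      have := abs_sub (x ^ 2) s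
      rwa [abs_of_nonneg (sq_nonneg x)] at this
    nlinarith
  have hsqi : Integrable (fun x : ℝ => x ^ 2) ν := by
    refine (hint.const_mul (1 / δ₀)).mono' (by fun_prop) (ae_of_all _ fun x => ?_)
    rw [Real.norm_of_nonneg (sq_nonneg x), div_mul_eq_mul_div, le_div_iff₀ hδ₀]
    have := Real.add_one_le_exp (δ₀ * x ^ 2)
    linarith
  obtain ⟨K, hK, hKt⟩ := lintegral_exp_le_of_centered (X := fun x : ℝ => x ^ 2 - s) (by fun_prop)
    (half_pos hδ₀) hint1 (by rw [integral_sub hsqi (integrable_const _), h0]; simp)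
  exact ⟨K, δ₀ / 2, hK, half_pos hδ₀, hKt⟩

end Law

/-- Linearization of a square by a Gaussian average turns a sub-Gaussian bound into an exponential
moment of the square. -/
lemma lintegral_exp_sq_le {α : Type*} [MeasurableSpace α] {μ : Measure α} [SFinite μ]
    {X : α → ℝ} (hX : Measurable X) {v : ℝ} (hv : 0 < v)
    (h : ∀ t : ℝ, ∫⁻ x, ENNReal.ofReal (Real.exp (t * X x)) ∂μ
      ≤ ENNReal.ofReal (Real.exp (v * t ^ 2))) :
    ∫⁻ x, ENNReal.ofReal (Real.exp (X x ^ 2 / (8 * v))) ∂μ ≤ 2 := by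
  set a : ℝ := 1 / (2 * √v) with ha
  have ha2 : a ^ 2 = 1 / (4 * v) := by
    rw [ha, div_pow, mul_pow, Real.sq_sqrt hv.le]; norm_num
  have hπ : 0 < √(Real.pi / (1 / 2)) := Real.sqrt_pos.mpr (by positivity)
  have gauss : ∀ b : ℝ, 0 < b → ∫⁻ g : ℝ, ENNReal.ofReal (Real.exp (-b * g ^ 2))
      = ENNReal.ofReal (√(Real.pi / b)) := by
    intro b hb
    rw [← integral_gaussian, ofReal_integral_eq_lintegral_ofReal (integrable_exp_neg_mul_sq hb)
      (ae_of_all _ fun x => (Real.exp_pos _).le)]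
  have hlin : ∀ y : ℝ, ∫⁻ g : ℝ, ENNReal.ofReal (Real.exp (-(1 / 2) * g ^ 2 + a * g * y))
      = ENNReal.ofReal (Real.exp (y ^ 2 / (8 * v))) * ENNReal.ofReal (√(Real.pi / (1 / 2))) := by
    intro y
    rw [← gauss _ (by norm_num), ← lintegral_const_mul _ (by fun_prop),
      ← lintegral_sub_right_eq_self (fun g : ℝ => ENNReal.ofReal (Real.exp (y ^ 2 / (8 * v)))
        * ENNReal.ofReal (Real.exp (-(1 / 2) * g ^ 2))) (a * y)]
    refine lintegral_congr fun g => ?_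
    rw [← ENNReal.ofReal_mul (Real.exp_pos _).le, ← Real.exp_add]
    congr 2
    have : y ^ 2 / (8 * v) = a ^ 2 * y ^ 2 / 2 := by rw [ha2]; field_simp; ring
    rw [this]
    ring
  have hmain : (∫⁻ x, ENNReal.ofReal (Real.exp (X x ^ 2 / (8 * v))) ∂μ)
      * ENNReal.ofReal (√(Real.pi / (1 / 2))) ≤ 2 * ENNReal.ofReal (√(Real.pi / (1 / 2))) := by
    rw [← lintegral_mul_const _ (by fun_prop)]
    simp_rw [← hlin]
    rw [lintegral_lintegral_swap (by fun_prop)]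
    calc ∫⁻ g : ℝ, ∫⁻ x, ENNReal.ofReal (Real.exp (-(1 / 2) * g ^ 2 + a * g * X x)) ∂μ
        ≤ ∫⁻ g : ℝ, ENNReal.ofReal (Real.exp (-(1 / 4) * g ^ 2)) := by
          refine lintegral_mono fun g => ?_
          simp_rw [Real.exp_add, ENNReal.ofReal_mul (Real.exp_pos _).le]
          rw [lintegral_const_mul _ (by fun_prop)]
          refine (mul_le_mul_right (h (a * g)) _).trans ?_
          rw [← ENNReal.ofReal_mul (Real.exp_pos _).le, ← Real.exp_add]
          refine ENNReal.ofReal_le_ofReal (Real.exp_le_exp.mpr (le_of_eq ?_))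
          rw [mul_pow, ha2]
          field_simp
          ring
      _ = ENNReal.ofReal (√(Real.pi / (1 / 4))) := gauss _ (by norm_num)
      _ ≤ ENNReal.ofReal (2 * √(Real.pi / (1 / 2))) := by
          apply ENNReal.ofReal_le_ofReal
          rw [show (2 : ℝ) = √4 by rw [show (4 : ℝ) = 2 ^ 2 by norm_num, Real.sqrt_sq (by norm_num)],
            ← Real.sqrt_mul (by norm_num)]
          apply Real.sqrt_le_sqrt
          have := Real.pi_pos
          norm_num
          linarith
      _ = _ := by rw [ENNReal.ofReal_mul (by norm_num)]; simp
  exact (ENNReal.mul_le_mul_iff_left (by simpa using hπ) ENNReal.ofReal_ne_top).mp hmain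

/-- The linear form `bᵢ + ∑_{j > i} Tᵢⱼ xⱼ` in the variables after the `i`-th one. -/
def tailForm {n : ℕ} (b : Fin n → ℝ) (T : Fin n → Fin n → ℝ) (i : Fin n) (x : Fin n → ℝ) : ℝ :=
  b i + ∑ j, if i < j then T i j * x j else 0

lemma measurable_tailForm {n : ℕ} (b : Fin n → ℝ) (T : Fin n → Fin n → ℝ) (i : Fin n) :
    Measurable (tailForm b T i) := by
  unfold tailForm
  refine measurable_const.add (Finset.measurable_sum _ fun j _ => ?_)
  split_ifs <;> fun_prop

/-- The supermartingale property: integrating out the variables one at a time. -/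
lemma lintegral_pi_prod_tailForm_le {ν : Measure ℝ} [IsProbabilityMeasure ν] {n : ℕ}
    (b : Fin n → ℝ) (T : Fin n → Fin n → ℝ) (F : Fin n → ℝ → ℝ → ENNReal)
    (hF : ∀ i, Measurable (Function.uncurry (F i))) (h1 : ∀ i y, ∫⁻ x, F i x y ∂ν ≤ 1) :
    ∫⁻ x, ∏ i, F i (x i) (tailForm b T i x) ∂(Measure.pi fun _ : Fin n => ν) ≤ 1 := by
  have hF' : ∀ {n : ℕ} (b : Fin n → ℝ) (T : Fin n → Fin n → ℝ) (F : Fin n → ℝ → ℝ → ENNReal),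
      (∀ i, Measurable (Function.uncurry (F i))) →
      Measurable fun x : Fin n → ℝ => ∏ i, F i (x i) (tailForm b T i x) := by
    intro n b T F hF
    refine Finset.measurable_prod _ fun i _ => ?_
    exact (hF i).comp ((measurable_pi_apply i).prodMk (measurable_tailForm b T i))
  induction n with
  | zero => simp
  | succ n ih =>
    have hmp := (measurePreserving_piFinSuccAbove (fun _ : Fin (n + 1) => ν) 0).symm
    rw [← hmp.lintegral_comp (hF' b T F hF)]
    simp_rw [MeasurableEquiv.piFinSuccAbove_symm_apply, Fin.insertNthEquiv, Equiv.coe_fn_mk,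
      Fin.insertNth_zero]
    have htail0 : ∀ (y : ℝ) (x : Fin n → ℝ), tailForm b T 0 (Fin.cons y x : Fin (n + 1) → ℝ)
        = b 0 + ∑ j : Fin n, T 0 j.succ * x j := by
      intro y x
      simp [tailForm, Fin.sum_univ_succ]
    have htail : ∀ (y : ℝ) (x : Fin n → ℝ) (i : Fin n),
        tailForm b T i.succ (Fin.cons y x : Fin (n + 1) → ℝ)
        = tailForm (fun i => b i.succ) (fun i j => T i.succ j.succ) i x := by
      intro y x i
      simp [tailForm, Fin.sum_univ_succ]
    have hmeas : Measurable fun p : ℝ × (Fin n → ℝ) =>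
        F 0 p.1 (b 0 + ∑ j : Fin n, T 0 j.succ * p.2 j) *
        ∏ i : Fin n, F i.succ (p.2 i)
          (tailForm (fun i => b i.succ) (fun i j => T i.succ j.succ) i p.2) := by
      refine Measurable.mul ?_ ?_
      · exact (hF 0).comp (measurable_fst.prodMk (by fun_prop))
      · exact (hF' (fun i => b i.succ) (fun i j => T i.succ j.succ) (fun i => F i.succ)
          (fun i => hF i.succ)).comp measurable_snd
    calc _ = ∫⁻ p : ℝ × (Fin n → ℝ), F 0 p.1 (b 0 + ∑ j : Fin n, T 0 j.succ * p.2 j) *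
        ∏ i : Fin n, F i.succ (p.2 i)
          (tailForm (fun i => b i.succ) (fun i j => T i.succ j.succ) i p.2)
          ∂(ν.prod (Measure.pi fun _ : Fin n => ν)) := by
          refine lintegral_congr fun p => ?_
          rw [Fin.prod_univ_succ]
          congr 1
          · exact congrArg₂ (F 0) rfl (htail0 p.1 p.2)
          · exact Finset.prod_congr rfl fun i _ => congrArg₂ (F i.succ) rfl (htail p.1 p.2 i)
      _ ≤ 1 := by
          rw [lintegral_prod_symm' _ hmeas]
          refine le_trans (lintegral_mono fun x => ?_) (ih (fun i => b i.succ)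
            (fun i j => T i.succ j.succ) (fun i => F i.succ) (fun i => hF i.succ)
            fun i y => h1 i.succ y)
          have hm : Measurable fun y => F 0 y (b 0 + ∑ j : Fin n, T 0 j.succ * x j) :=
            (hF 0).comp (measurable_id.prodMk measurable_const)
          dsimp only
          rw [lintegral_mul_const _ hm]
          exact mul_le_of_le_one_left (by positivity) (h1 0 _)

section Pi

variable {ν : Measure ℝ} [IsProbabilityMeasure ν] {v : ℝ} (hsub : IsSubgaussianLaw ν v)
include hsub

/-- The exponential supermartingale attached to `∑ xᵢ Lᵢ`, where `Lᵢ` is an affine form in the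
variables after the `i`-th one. -/
lemma lintegral_exp_tailForm_le {n : ℕ} (b : Fin n → ℝ) (T : Fin n → Fin n → ℝ) :
    ∫⁻ x, ENNReal.ofReal (Real.exp (∑ i, (tailForm b T i x * x i - v * tailForm b T i x ^ 2)))
      ∂(Measure.pi fun _ : Fin n => ν) ≤ 1 := by
  have h := lintegral_pi_prod_tailForm_le (ν := ν) b T
    (fun _ x y => ENNReal.ofReal (Real.exp (y * x - v * y ^ 2)))
    (fun _ => by simp only [Function.uncurry_def]; fun_prop) (fun _ y => by
      simp_rw [sub_eq_add_neg, Real.exp_add, ENNReal.ofReal_mul (Real.exp_pos _).le]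
      rw [lintegral_mul_const _ (by fun_prop)]
      refine (mul_le_mul_left (hsub y) _).trans (le_of_eq ?_)
      rw [← ENNReal.ofReal_mul (Real.exp_pos _).le, ← Real.exp_add]
      simp)
  refine le_trans (lintegral_mono fun x => ?_) h
  rw [Real.exp_sum, ENNReal.ofReal_prod_of_nonneg fun i _ => (Real.exp_pos _).le]

lemma lintegral_exp_linear_le {n : ℕ} (b : Fin n → ℝ) (t : ℝ) :
    ∫⁻ x, ENNReal.ofReal (Real.exp (t * ∑ i, b i * x i)) ∂(Measure.pi fun _ : Fin n => ν)
      ≤ ENNReal.ofReal (Real.exp (v * (∑ i, b i ^ 2) * t ^ 2)) := by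
  have h := lintegral_exp_tailForm_le hsub (fun i => t * b i) (fun _ _ : Fin n => 0)
  have h1 : ∀ (i : Fin n) (x : Fin n → ℝ), tailForm (fun i => t * b i) (fun _ _ => 0) i x
      = t * b i := by
    intro i x
    simp [tailForm]
  simp_rw [h1] at h
  have h2 : ∀ x : Fin n → ℝ, ENNReal.ofReal (Real.exp (t * ∑ i, b i * x i))
      = ENNReal.ofReal (Real.exp (∑ i, (t * b i * x i - v * (t * b i) ^ 2)))
        * ENNReal.ofReal (Real.exp (v * (∑ i, b i ^ 2) * t ^ 2)) := by
    intro x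
    rw [← ENNReal.ofReal_mul (Real.exp_pos _).le, ← Real.exp_add]
    congr 2
    rw [Finset.sum_sub_distrib, Finset.mul_sum, Finset.mul_sum, Finset.sum_mul, sub_add,
      ← Finset.sum_sub_distrib]
    simp only [mul_pow]
    rw [Finset.sum_eq_zero (s := univ) (f := fun i => v * (t ^ 2 * b i ^ 2) - v * b i ^ 2 * t ^ 2),
      sub_zero]
    · exact Finset.sum_congr rfl fun i _ => by ring
    · intro i _; ring
  simp_rw [h2]
  rw [lintegral_mul_const _ (by fun_prop)]
  exact mul_le_of_le_one_left (by positivity) h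

lemma lintegral_exp_linear_sq_le (hv : 0 < v) {n : ℕ} (b : Fin n → ℝ) :
    ∫⁻ x, ENNReal.ofReal (Real.exp ((∑ i, b i * x i) ^ 2 / (8 * (v * ∑ i, b i ^ 2))))
      ∂(Measure.pi fun _ : Fin n => ν) ≤ 2 := by
  rcases (Finset.sum_nonneg fun i (_ : i ∈ univ) => sq_nonneg (b i)).eq_or_lt with h | h
  · rw [← h]
    simp
  · exact lintegral_exp_sq_le (by fun_prop) (mul_pos hv h) (lintegral_exp_linear_le hsub b)

/-- Exponential moments of a sum of squares of linear forms, by convexity. -/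
lemma lintegral_exp_sum_sq_le (hv : 0 < v) {n : ℕ} (T : Fin n → Fin n → ℝ) {W : ℝ} (hW : 0 < W)
    (hT : ∑ i, ∑ j, T i j ^ 2 ≤ W) :
    ∫⁻ x, ENNReal.ofReal (Real.exp (∑ i, (∑ j, T i j * x j) ^ 2 / (8 * v * W)))
      ∂(Measure.pi fun _ : Fin n => ν) ≤ 2 := by
  set w : Fin n → ℝ := fun i => ∑ j, T i j ^ 2 with hw
  have hw0 : ∀ i, 0 ≤ w i := fun i => Finset.sum_nonneg fun j _ => sq_nonneg _
  have hsum1 : ∑ i, w i / W ≤ 1 := by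
    rw [← Finset.sum_div]; exact div_le_one_of_le₀ hT hW.le
  have hptw : ∀ x : Fin n → ℝ, Real.exp (∑ i, (∑ j, T i j * x j) ^ 2 / (8 * v * W))
      ≤ (1 - ∑ i, w i / W)
        + ∑ i, w i / W * Real.exp ((∑ j, T i j * x j) ^ 2 / (8 * (v * w i))) := by
    intro x
    have h := convexOn_exp.map_add_sum_le (t := univ) (w := fun i => w i / W)
      (v := 1 - ∑ i, w i / W) (q := 0)
      (p := fun i => (∑ j, T i j * x j) ^ 2 / (8 * (v * w i)))
      (fun i _ => div_nonneg (hw0 i) hW.le) (by ring) (fun _ _ => Set.mem_univ _)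
      (by linarith) (Set.mem_univ _)
    simp only [smul_eq_mul, mul_zero, zero_add, Real.exp_zero, mul_one] at h
    refine le_trans (le_of_eq ?_) h
    congr 1
    refine Finset.sum_congr rfl fun i _ => ?_
    rcases (hw0 i).eq_or_lt with h0 | h0
    · have hz : ∀ j, T i j = 0 := fun j => by
        have := (Finset.sum_eq_zero_iff_of_nonneg fun j _ => sq_nonneg (T i j)).mp h0.symm j
          (Finset.mem_univ j)
        exact pow_eq_zero_iff (two_ne_zero) |>.mp this
      simp [hz]
    · field_simp
  calc _ ≤ ∫⁻ x, (ENNReal.ofReal (1 - ∑ i, w i / W) + ∑ i, ENNReal.ofReal (w i / W) *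
          ENNReal.ofReal (Real.exp ((∑ j, T i j * x j) ^ 2 / (8 * (v * w i)))))
          ∂(Measure.pi fun _ : Fin n => ν) := by
        refine lintegral_mono fun x => (ENNReal.ofReal_le_ofReal (hptw x)).trans ?_
        refine ENNReal.ofReal_add_le.trans (add_le_add le_rfl ?_)
        rw [ENNReal.ofReal_sum_of_nonneg fun i _ =>
          mul_nonneg (div_nonneg (hw0 i) hW.le) (Real.exp_pos _).le]
        exact Finset.sum_le_sum fun i _ => by rw [ENNReal.ofReal_mul (div_nonneg (hw0 i) hW.le)]
    _ = ENNReal.ofReal (1 - ∑ i, w i / W) + ∑ i, ENNReal.ofReal (w i / W) *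
          ∫⁻ x, ENNReal.ofReal (Real.exp ((∑ j, T i j * x j) ^ 2 / (8 * (v * w i))))
          ∂(Measure.pi fun _ : Fin n => ν) := by
        rw [lintegral_add_left (by fun_prop), lintegral_finsetSum _ fun i _ => by fun_prop]
        simp only [lintegral_const, measure_univ, mul_one]
        congr 1
        exact Finset.sum_congr rfl fun i _ => by rw [lintegral_const_mul _ (by fun_prop)]
    _ ≤ ENNReal.ofReal (1 - ∑ i, w i / W) + ∑ i, ENNReal.ofReal (w i / W) * 2 := by
        gcongr with i _
        exact lintegral_exp_linear_sq_le hsub hv _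
    _ ≤ ENNReal.ofReal 2 := by
        rw [← Finset.sum_mul, ← ENNReal.ofReal_sum_of_nonneg fun i _ => div_nonneg (hw0 i) hW.le,
          show (2 : ENNReal) = ENNReal.ofReal 2 by simp,
          ← ENNReal.ofReal_mul (Finset.sum_nonneg fun i _ => div_nonneg (hw0 i) hW.le),
          ← ENNReal.ofReal_add (by linarith) (mul_nonneg (Finset.sum_nonneg fun i _ =>
            div_nonneg (hw0 i) hW.le) (by norm_num))]
        exact ENNReal.ofReal_le_ofReal (by linarith)
    _ = 2 := by simp

/-- Exponential moments of the off-diagonal part of a quadratic form. It is a sum `∑ xᵢ Lᵢ` with `Lᵢ`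
a linear form in the later variables. The exponential supermartingale controls it up to the
compensator `∑ Lᵢ²`, a sum of squares of linear forms, and the two are separated by the
Cauchy-Schwarz inequality. -/
lemma lintegral_exp_offdiag_le (hv : 0 < v) {n : ℕ} (T : Fin n → Fin n → ℝ) {W : ℝ} (hW : 0 < W)
    (hT : ∑ i, ∑ j, T i j ^ 2 ≤ W) {lam : ℝ} (hlam : 32 * v ^ 2 * lam ^ 2 * W = 1) :
    ∫⁻ x, ENNReal.ofReal (Real.exp (lam * ∑ i, x i * ∑ j, if i < j then T i j * x j else 0))
      ∂(Measure.pi fun _ : Fin n => ν) ≤ 2 := by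
  set L : Fin n → (Fin n → ℝ) → ℝ := fun i x => ∑ j, if i < j then T i j * x j else 0 with hL
  have hLm : ∀ i, Measurable (L i) := fun i => by
    refine Finset.measurable_sum _ fun j _ => ?_
    split_ifs <;> fun_prop
  set T' : Fin n → Fin n → ℝ := fun i j => if i < j then T i j else 0 with hT'
  have hLT : ∀ i x, L i x = ∑ j, T' i j * x j := fun i x =>
    Finset.sum_congr rfl fun j _ => by simp only [hT']; split_ifs <;> simp
  have hTT : ∑ i, ∑ j, T' i j ^ 2 ≤ W := by
    refine le_trans (Finset.sum_le_sum fun i _ => Finset.sum_le_sum fun j _ => ?_) hT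
    simp only [hT']
    split_ifs
    · exact le_rfl
    · simpa using sq_nonneg (T i j)
  have h1 := lintegral_exp_tailForm_le hsub (fun _ => 0) (fun i j => 2 * lam * T i j)
  have h2 := lintegral_exp_sum_sq_le hsub hv T' hW hTT
  have htail : ∀ (i : Fin n) (x : Fin n → ℝ),
      tailForm (fun _ => 0) (fun i j => 2 * lam * T i j) i x = 2 * lam * L i x := by
    intro i x
    simp only [tailForm, zero_add, hL, Finset.mul_sum]
    refine Finset.sum_congr rfl fun j _ => ?_
    split_ifs <;> ring
  simp_rw [htail] at h1
  simp_rw [← hLT] at h2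
  have hptw : ∀ x : Fin n → ℝ, Real.exp (lam * ∑ i, x i * L i x)
      ≤ Real.exp (∑ i, (2 * lam * L i x * x i - v * (2 * lam * L i x) ^ 2)) / 2
        + Real.exp (∑ i, L i x ^ 2 / (8 * v * W)) / 2 := by
    intro x
    -- `hlam` makes the compensator equal to the exponent in `lintegral_exp_sum_sq_le`
    set A := ∑ i, (2 * lam * L i x * x i - v * (2 * lam * L i x) ^ 2) with hA
    set B := ∑ i, L i x ^ 2 / (8 * v * W) with hB
    have hAB : lam * ∑ i, x i * L i x = A / 2 + B / 2 := by
      rw [hA, hB, ← add_div, ← Finset.sum_add_distrib, Finset.mul_sum, Finset.sum_div]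
      refine Finset.sum_congr rfl fun i _ => ?_
      have : L i x ^ 2 / (8 * v * W) = v * (2 * lam * L i x) ^ 2 := by
        rw [div_eq_iff (by positivity)]
        linear_combination (-L i x ^ 2) * hlam
      rw [this]
      ring
    rw [hAB, Real.exp_add]
    have e1 : Real.exp A = Real.exp (A / 2) ^ 2 := by rw [← Real.exp_nat_mul]; congr 1; push_cast; ring
    have e2 : Real.exp B = Real.exp (B / 2) ^ 2 := by rw [← Real.exp_nat_mul]; congr 1; push_cast; ring
    rw [e1, e2]
    nlinarith [sq_nonneg (Real.exp (A / 2) - Real.exp (B / 2))]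
  have hm1 : Measurable fun x : Fin n → ℝ => ENNReal.ofReal
      (Real.exp (∑ i, (2 * lam * L i x * x i - v * (2 * lam * L i x) ^ 2))) := by fun_prop
  calc _ ≤ ∫⁻ x, (ENNReal.ofReal
          (Real.exp (∑ i, (2 * lam * L i x * x i - v * (2 * lam * L i x) ^ 2)))
          * ENNReal.ofReal (1 / 2)
        + ENNReal.ofReal (Real.exp (∑ i, L i x ^ 2 / (8 * v * W))) * ENNReal.ofReal (1 / 2))
        ∂(Measure.pi fun _ : Fin n => ν) := by
        refine lintegral_mono fun x => (ENNReal.ofReal_le_ofReal (hptw x)).trans ?_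
        rw [← ENNReal.ofReal_mul (Real.exp_pos _).le, ← ENNReal.ofReal_mul (Real.exp_pos _).le,
          ← ENNReal.ofReal_add (by positivity) (by positivity)]
        apply ENNReal.ofReal_le_ofReal
        linarith
    _ ≤ 1 * ENNReal.ofReal (1 / 2) + 2 * ENNReal.ofReal (1 / 2) := by
        rw [lintegral_add_left (hm1.mul_const _), lintegral_mul_const _ hm1,
          lintegral_mul_const _ (by fun_prop)]
        gcongr
    _ ≤ 2 := by
        rw [← add_mul, show (1 : ENNReal) + 2 = ENNReal.ofReal 3 by norm_num,
          ← ENNReal.ofReal_mul (by norm_num), show (2 : ENNReal) = ENNReal.ofReal 2 by simp]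
        exact ENNReal.ofReal_le_ofReal (by norm_num)

omit hsub in
/-- Exponential moments of the diagonal part of a quadratic form. -/
lemma lintegral_exp_diag_le {s D β : ℝ}
    (hdiag : ∀ b : ℝ, |b| ≤ β → ∫⁻ x, ENNReal.ofReal (Real.exp (b * (x ^ 2 - s))) ∂ν
        ≤ ENNReal.ofReal (Real.exp (D * b ^ 2))) {n : ℕ} (b : Fin n → ℝ) (hb : ∀ i, |b i| ≤ β) :
    ∫⁻ x, ENNReal.ofReal (Real.exp (∑ i, b i * (x i ^ 2 - s))) ∂(Measure.pi fun _ : Fin n => ν)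
      ≤ ENNReal.ofReal (Real.exp (D * ∑ i, b i ^ 2)) := by
  have h := lintegral_pi_prod_tailForm_le (ν := ν) (fun _ => 0) (fun _ _ => 0)
    (fun i x _ => ENNReal.ofReal (Real.exp (b i * (x ^ 2 - s) - D * b i ^ 2)))
    (fun i => by simp only [Function.uncurry_def]; fun_prop) (fun i y => by
      simp_rw [sub_eq_add_neg (b i * _), Real.exp_add, ENNReal.ofReal_mul (Real.exp_pos _).le]
      rw [lintegral_mul_const _ (by fun_prop)]
      refine (mul_le_mul_left (hdiag (b i) (hb i)) _).trans (le_of_eq ?_)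
      rw [← ENNReal.ofReal_mul (Real.exp_pos _).le, ← Real.exp_add]
      simp)
  have h2 : ∀ x : Fin n → ℝ, ENNReal.ofReal (Real.exp (∑ i, b i * (x i ^ 2 - s)))
      = (∏ i, ENNReal.ofReal (Real.exp (b i * (x i ^ 2 - s) - D * b i ^ 2)))
        * ENNReal.ofReal (Real.exp (D * ∑ i, b i ^ 2)) := by
    intro x
    rw [← ENNReal.ofReal_prod_of_nonneg fun i _ => (Real.exp_pos _).le, ← Real.exp_sum,
      ← ENNReal.ofReal_mul (Real.exp_pos _).le, ← Real.exp_add, Finset.sum_sub_distrib,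
      ← Finset.mul_sum]
    congr 2
    ring
  simp_rw [h2]
  rw [lintegral_mul_const _ (by fun_prop)]
  exact mul_le_of_le_one_left (by positivity) h

end Pi

/-- The Chernoff bound for both tails. -/
lemma measureReal_abs_ge_le {α : Type*} [MeasurableSpace α] {μ : Measure α} [IsFiniteMeasure μ]
    {f : α → ℝ} (hf : Measurable f) {K : ℝ} (hK : 0 ≤ K)
    (h1 : ∫⁻ x, ENNReal.ofReal (Real.exp (f x)) ∂μ ≤ ENNReal.ofReal K)
    (h2 : ∫⁻ x, ENNReal.ofReal (Real.exp (-f x)) ∂μ ≤ ENNReal.ofReal K) (t : ℝ) :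
    μ.real {x | t ≤ |f x|} ≤ 2 * K * Real.exp (-t) := by
  have key : ∀ g : α → ℝ, Measurable g →
      ∫⁻ x, ENNReal.ofReal (Real.exp (g x)) ∂μ ≤ ENNReal.ofReal K →
      μ.real {x | t ≤ g x} ≤ K * Real.exp (-t) := by
    intro g hg h
    have hset : {x | t ≤ g x} ⊆ {x | ENNReal.ofReal (Real.exp t) ≤ ENNReal.ofReal (Real.exp (g x))} :=
      fun x hx => ENNReal.ofReal_le_ofReal (Real.exp_le_exp.mpr hx)
    have hm := meas_ge_le_lintegral_div (μ := μ) (f := fun x => ENNReal.ofReal (Real.exp (g x)))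
      (by fun_prop) (ε := ENNReal.ofReal (Real.exp t))
      (by simpa using Real.exp_pos t) ENNReal.ofReal_ne_top
    have : μ {x | t ≤ g x} ≤ ENNReal.ofReal (K * Real.exp (-t)) := by
      refine (measure_mono hset).trans (hm.trans ?_)
      rw [Real.exp_neg, ← div_eq_mul_inv, ENNReal.ofReal_div_of_pos (Real.exp_pos t)]
      gcongr
    exact ENNReal.toReal_le_of_le_ofReal (by positivity) this
  have hsub : {x | t ≤ |f x|} ⊆ {x | t ≤ f x} ∪ {x | t ≤ -f x} := fun x hx => by
    simpa only [Set.mem_union, Set.mem_ofPred_eq, le_abs] using hx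
  calc _ ≤ μ.real ({x | t ≤ f x} ∪ {x | t ≤ -f x}) := measureReal_mono hsub
    _ ≤ μ.real {x | t ≤ f x} + μ.real {x | t ≤ -f x} := measureReal_union_le _ _
    _ ≤ K * Real.exp (-t) + K * Real.exp (-t) :=
        add_le_add (key f hf h1) (key (fun x => -f x) hf.neg h2)
    _ = _ := by ring

/-- Splitting of a quadratic form into its off-diagonal part, ordered so that each variable is
multiplied by a linear form in the later ones, and its diagonal part. -/
lemma quadratic_sum_split {n : ℕ} (B : Fin n → Fin n → ℝ) (x : Fin n → ℝ) :
    ∑ i, ∑ j, B i j * x i * x j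
      = (∑ i, x i * ∑ j, if i < j then (B i j + B j i) * x j else 0) + ∑ i, B i i * x i ^ 2 := by
  have h1 : ∀ i j, B i j * x i * x j = (if i < j then B i j * x i * x j else 0)
      + (if j < i then B i j * x i * x j else 0) + (if i = j then B i j * x i * x j else 0) := by
    intro i j
    rcases lt_trichotomy i j with h | h | h
    · simp [h, h.not_gt, h.ne]
    · subst h
      simp only [lt_irrefl, if_false, if_true, zero_add]
    · rw [if_neg h.not_gt, if_pos h, if_neg h.ne', zero_add, add_zero]
  rw [Finset.sum_congr rfl fun i _ => Finset.sum_congr rfl fun j _ => h1 i j]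
  simp_rw [Finset.sum_add_distrib]
  rw [Finset.sum_comm (f := fun i j => if j < i then B i j * x i * x j else 0)]
  rw [← Finset.sum_add_distrib]
  congr 1
  · refine Finset.sum_congr rfl fun i _ => ?_
    rw [← Finset.sum_add_distrib, Finset.mul_sum]
    refine Finset.sum_congr rfl fun j _ => ?_
    split_ifs <;> ring
  · refine Finset.sum_congr rfl fun i _ => ?_
    rw [Finset.sum_ite_eq]
    simp
    ring

/-- A Hanson-Wright type inequality: quadratic forms in independent sub-Gaussian variables
concentrate around their mean on the scale of their Hilbert-Schmidt norm, with exponential tails. -/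
lemma quadratic_tail_pi {ν : Measure ℝ} [IsProbabilityMeasure ν] {v s D β : ℝ} (hv : 0 < v)
    (hsub : IsSubgaussianLaw ν v) (hD : 0 < D) (hβ : 0 < β)
    (hdiag : ∀ b : ℝ, |b| ≤ β → ∫⁻ x, ENNReal.ofReal (Real.exp (b * (x ^ 2 - s))) ∂ν
        ≤ ENNReal.ofReal (Real.exp (D * b ^ 2))) :
    ∃ C c : ℝ, 0 < C ∧ 0 < c ∧ ∀ (n : ℕ) (B : Fin n → Fin n → ℝ) (r t : ℝ), 0 < r → 0 ≤ t →
      ∑ i, ∑ j, B i j ^ 2 ≤ r ^ 2 →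
      (Measure.pi fun _ : Fin n => ν).real
        {x | t ≤ |∑ i, ∑ j, B i j * x i * x j - s * ∑ i, B i i|} ≤ C * Real.exp (-c * t / r) := by
  -- the off-diagonal part allows an exponent `1 / (16 v r)`, the diagonal part `β / r`
  set κ := min (1 / (16 * v)) β with hκ
  have hκ0 : 0 < κ := lt_min (by positivity) hβ
  set K := Real.exp (D * β ^ 2) with hK
  refine ⟨2 * 2 + 2 * K, κ / 2, by positivity, by positivity, fun n B r t hr ht hB => ?_⟩
  set S₁ : (Fin n → ℝ) → ℝ := fun x => ∑ i, x i * ∑ j, if i < j then (B i j + B j i) * x j else 0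
    with hS₁
  set S₂ : (Fin n → ℝ) → ℝ := fun x => ∑ i, B i i * (x i ^ 2 - s) with hS₂
  have hm1 : Measurable S₁ := by
    refine Finset.measurable_sum _ fun i _ => (measurable_pi_apply i).mul
      (Finset.measurable_sum _ fun j _ => ?_)
    split_ifs <;> fun_prop
  have hm2 : Measurable S₂ := by fun_prop
  have hsplit : ∀ x : Fin n → ℝ, ∑ i, ∑ j, B i j * x i * x j - s * ∑ i, B i i = S₁ x + S₂ x := by
    intro x
    rw [quadratic_sum_split, hS₁, hS₂]
    simp only [mul_sub, Finset.sum_sub_distrib, Finset.mul_sum]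
    rw [add_sub_assoc]
    congr 2
    exact Finset.sum_congr rfl fun i _ => mul_comm _ _
  have hT : ∑ i, ∑ j, (B i j + B j i) ^ 2 ≤ 8 * r ^ 2 := by
    calc ∑ i, ∑ j, (B i j + B j i) ^ 2 ≤ ∑ i, ∑ j, (2 * B i j ^ 2 + 2 * B j i ^ 2) :=
          Finset.sum_le_sum fun i _ => Finset.sum_le_sum fun j _ => by
            nlinarith [sq_nonneg (B i j - B j i)]
      _ = 4 * ∑ i, ∑ j, B i j ^ 2 := by
          simp_rw [Finset.sum_add_distrib, ← Finset.mul_sum]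
          rw [Finset.sum_comm (f := fun i j => B j i ^ 2)]
          ring
      _ ≤ _ := by nlinarith
  set lam := 1 / (16 * v * r) with hlam
  have hlam0 : 0 < lam := by positivity
  have hlam2 : 32 * v ^ 2 * lam ^ 2 * (8 * r ^ 2) = 1 := by
    rw [hlam]; field_simp; norm_num
  have b1 : (Measure.pi fun _ : Fin n => ν).real {x | lam * (t / 2) ≤ |lam * S₁ x|}
      ≤ 2 * 2 * Real.exp (-(lam * (t / 2))) := by
    refine measureReal_abs_ge_le (by fun_prop) (by norm_num) ?_ ?_ _
    · simpa using lintegral_exp_offdiag_le hsub hv (fun i j => B i j + B j i) (by positivity) hT hlam2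
    · have := lintegral_exp_offdiag_le hsub hv (fun i j => B i j + B j i) (by positivity) hT
        (lam := -lam) (by rw [neg_sq]; exact hlam2)
      simpa only [neg_mul, ENNReal.ofReal_ofNat] using this
  have hBii : ∑ i, B i i ^ 2 ≤ r ^ 2 := by
    refine le_trans (Finset.sum_le_sum fun i _ => ?_) hB
    exact Finset.single_le_sum (f := fun j => B i j ^ 2) (fun j _ => sq_nonneg _) (Finset.mem_univ i)
  have hBabs : ∀ i, |B i i| ≤ r := fun i => by
    refine abs_le_of_sq_le_sq ?_ hr.le
    exact (Finset.single_le_sum (f := fun i => B i i ^ 2) (fun j _ => sq_nonneg _)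
      (Finset.mem_univ i)).trans hBii
  have hdiag' : ∀ σ : ℝ, |σ| = β / r →
      ∫⁻ x, ENNReal.ofReal (Real.exp (σ * S₂ x)) ∂(Measure.pi fun _ : Fin n => ν)
        ≤ ENNReal.ofReal K := by
    intro σ hσ
    have h := lintegral_exp_diag_le hdiag (fun i => σ * B i i) (fun i => by
      rw [abs_mul, hσ, div_mul_eq_mul_div, div_le_iff₀ hr]
      gcongr
      exact hBabs i)
    simp only [hS₂, Finset.mul_sum, ← mul_assoc]
    refine h.trans (ENNReal.ofReal_le_ofReal (Real.exp_le_exp.mpr ?_))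
    gcongr
    simp only [mul_pow, ← Finset.mul_sum]
    rw [← sq_abs σ, hσ, div_pow, div_mul_eq_mul_div, div_le_iff₀ (by positivity)]
    gcongr
  have b2 : (Measure.pi fun _ : Fin n => ν).real {x | β / r * (t / 2) ≤ |β / r * S₂ x|}
      ≤ 2 * K * Real.exp (-(β / r * (t / 2))) := by
    have hβr : 0 < β / r := by positivity
    refine measureReal_abs_ge_le (by fun_prop) (Real.exp_pos _).le ?_ ?_ _
    · exact hdiag' _ (abs_of_pos hβr)
    · have := hdiag' (-(β / r)) (by rw [abs_neg, abs_of_pos hβr])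
      simpa only [neg_mul] using this
  have hincl : {x | t ≤ |∑ i, ∑ j, B i j * x i * x j - s * ∑ i, B i i|}
      ⊆ {x | lam * (t / 2) ≤ |lam * S₁ x|} ∪ {x | β / r * (t / 2) ≤ |β / r * S₂ x|} := by
    intro x hx
    simp only [Set.mem_ofPred_eq, Set.mem_union] at hx ⊢
    rw [hsplit] at hx
    rw [abs_mul, abs_mul, abs_of_pos hlam0, abs_of_pos (by positivity : 0 < β / r),
      mul_le_mul_iff_right₀ hlam0, mul_le_mul_iff_right₀ (by positivity)]
    by_contra! hcon
    have := abs_add_le (S₁ x) (S₂ x)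
    linarith
  have e1 : Real.exp (-(lam * (t / 2))) ≤ Real.exp (-(κ / 2) * t / r) := by
    rw [Real.exp_le_exp]
    have : κ ≤ 1 / (16 * v) := min_le_left _ _
    have h2 : κ / r ≤ lam := by
      rw [hlam, ← div_div]
      gcongr
    have h3 : -(κ / 2) * t / r = -(κ / r * (t / 2)) := by ring
    rw [h3, neg_le_neg_iff]
    gcongr
  have e2 : Real.exp (-(β / r * (t / 2))) ≤ Real.exp (-(κ / 2) * t / r) := by
    rw [Real.exp_le_exp]
    have : κ ≤ β := min_le_right _ _
    have h3 : -(κ / 2) * t / r = -(κ / r * (t / 2)) := by ring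
    rw [h3, neg_le_neg_iff]
    gcongr
  calc _ ≤ _ := measureReal_mono hincl
    _ ≤ _ := measureReal_union_le _ _
    _ ≤ 2 * 2 * Real.exp (-(κ / 2) * t / r) + 2 * K * Real.exp (-(κ / 2) * t / r) := by
        refine add_le_add (b1.trans ?_) (b2.trans ?_) <;> gcongr
    _ = _ := by ring

/-- The law `ν` satisfies a Hanson-Wright type inequality with constants `C`, `c`: complex quadratic
forms in independent variables of law `ν` with second moment `s` concentrate around their mean. -/
def QuadraticConcentration (ν : Measure ℝ) (s C c : ℝ) : Prop :=
  ∀ (n : ℕ) (B : Fin n → Fin n → ℂ) (r t : ℝ), 0 < r → 0 ≤ t →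
    ∑ i, ∑ j, Complex.normSq (B i j) ≤ r ^ 2 →
      (Measure.pi fun _ : Fin n => ν).real
        {x | t ≤ ‖∑ i, ∑ j, B i j * x i * x j - s * ∑ i, B i i‖} ≤ C * Real.exp (-c * t / r)

/-- The complex form of the concentration inequality, from the real one applied to the real and
imaginary parts. -/
lemma exists_quadraticConcentration {ν : Measure ℝ} {s : ℝ} (hν : IsCenteredLaw ν s) {δ₀ : ℝ}
    (hδ₀ : 0 < δ₀) (hint : Integrable (fun x : ℝ => Real.exp (δ₀ * x ^ 2)) ν) :
    ∃ C c : ℝ, 0 < C ∧ 0 < c ∧ QuadraticConcentration ν s C c := by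
  have := hν.isProbabilityMeasure
  have hs : ∫ x, x ^ 2 ∂ν = s := by
    rw [← hν.variance_eq, variance_of_integral_eq_zero aemeasurable_id (by simpa using hν.mean_eq)]
    rfl
  obtain ⟨v, hv, hsub⟩ := exists_isSubgaussianLaw hδ₀ hint hν.mean_eq
  obtain ⟨D, β, hD, hβ, hdiag⟩ := exists_lintegral_exp_sq_sub_le hδ₀ hint hs
  obtain ⟨C, c, hC, hc, h⟩ := quadratic_tail_pi hv hsub hD hβ hdiag
  refine ⟨2 * C, c / 2, by positivity, by positivity, fun n B r t hr ht hB => ?_⟩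
  have hre := h n (fun i j => (B i j).re) r (t / 2) hr (by positivity) (le_trans
    (Finset.sum_le_sum fun i _ => Finset.sum_le_sum fun j _ => by
      rw [Complex.normSq_apply]; nlinarith [sq_nonneg (B i j).im]) hB)
  have him := h n (fun i j => (B i j).im) r (t / 2) hr (by positivity) (le_trans
    (Finset.sum_le_sum fun i _ => Finset.sum_le_sum fun j _ => by
      rw [Complex.normSq_apply]; nlinarith [sq_nonneg (B i j).re]) hB)
  have hincl : {x : Fin n → ℝ | t ≤ ‖∑ i, ∑ j, B i j * x i * x j - s * ∑ i, B i i‖}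
      ⊆ {x | t / 2 ≤ |∑ i, ∑ j, (B i j).re * x i * x j - s * ∑ i, (B i i).re|}
        ∪ {x | t / 2 ≤ |∑ i, ∑ j, (B i j).im * x i * x j - s * ∑ i, (B i i).im|} := by
    intro x hx
    simp only [Set.mem_ofPred_eq, Set.mem_union] at hx ⊢
    have h1 := Complex.norm_le_abs_re_add_abs_im
      (∑ i, ∑ j, B i j * x i * x j - s * ∑ i, B i i)
    simp only [Complex.sub_re, Complex.sub_im, Complex.re_sum, Complex.im_sum,
      Complex.re_mul_ofReal, Complex.im_mul_ofReal, Complex.re_ofReal_mul,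
      Complex.im_ofReal_mul] at h1
    by_contra! hcon
    linarith [hcon.1, hcon.2]
  calc _ ≤ _ := measureReal_mono hincl
    _ ≤ _ := measureReal_union_le _ _
    _ ≤ _ := add_le_add hre him
    _ = _ := by
        rw [show -c * (t / 2) / r = -(c / 2) * t / r by ring]; ring

/-- The concentration inequality for independent random variables indexed by any finite type. -/
lemma QuadraticConcentration.tail {ν : Measure ℝ} [IsProbabilityMeasure ν] {s C c : ℝ}
    (h : QuadraticConcentration ν s C c) {Ω : Type*} [MeasurableSpace Ω] {P : Measure Ω}
    [IsProbabilityMeasure P] {ι : Type*} [Fintype ι] {w : ι → Ω → ℝ} (hw : ∀ i, Measurable (w i))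
    (hlaw : ∀ i, P.map (w i) = ν) (hind : iIndepFun w P) (B : ι → ι → ℂ) {r t : ℝ} (hr : 0 < r)
    (ht : 0 ≤ t) (hB : ∑ i, ∑ j, Complex.normSq (B i j) ≤ r ^ 2) :
    P.real {ω | t ≤ ‖∑ i, ∑ j, B i j * w i ω * w j ω - s * ∑ i, B i i‖}
      ≤ C * Real.exp (-c * t / r) := by
  set e := (Fintype.equivFin ι).symm with he
  have hmap : P.map (fun ω i => w (e i) ω) = Measure.pi fun _ => ν := by
    rw [(iIndepFun_iff_map_fun_eq_pi_map fun i => (hw (e i)).aemeasurable).mp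
      (hind.precomp e.injective)]
    simp_rw [hlaw]
  have h1 := h _ (fun i j => B (e i) (e j)) r t hr ht (le_of_eq_of_le
    (Fintype.sum_equiv e _ _ fun i => Fintype.sum_equiv e _ (fun j => Complex.normSq (B (e i) j))
      fun j => rfl) hB)
  rw [← hmap, map_measureReal_apply (measurable_pi_lambda _ fun i => hw (e i))
    (measurableSet_le measurable_const (by fun_prop))] at h1
  refine le_trans (le_of_eq ?_) h1
  congr 1
  ext ω
  simp only [Set.mem_ofPred_eq, Set.mem_preimage]
  rw [Fintype.sum_equiv e (fun i => B (e i) (e i)) (fun i => B i i) fun i => rfl,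
    Fintype.sum_equiv e (fun i => ∑ j, B (e i) (e j) * w (e i) ω * w (e j) ω)
      (fun i => ∑ j, B i j * w i ω * w j ω) fun i => Fintype.sum_equiv e _
      (fun j => B (e i) j * w (e i) ω * w j ω) fun j => rfl]

/-! ### Probability estimates for the resolvent -/

variable {N : ℕ}

lemma measurable_resolvent_apply (z : ℂ) (k l : Fin N) :
    Measurable fun A : Fin N → Fin N → ℂ => resolvent (Matrix.of A) z k l := by
  have hsub : Continuous fun A : Fin N → Fin N → ℂ =>
      (Matrix.of A - z • (1 : Matrix (Fin N) (Fin N) ℂ)) :=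
    Continuous.sub (continuous_id : Continuous fun A : Fin N → Fin N → ℂ => A) continuous_const
  have h : (fun A : Fin N → Fin N → ℂ => resolvent (Matrix.of A) z k l) = fun A =>
      (Matrix.det (Matrix.of A - z • (1 : Matrix (Fin N) (Fin N) ℂ)))⁻¹ *
        Matrix.adjugate (Matrix.of A - z • (1 : Matrix (Fin N) (Fin N) ℂ)) k l := by
    funext A
    rw [resolvent, Matrix.inv_def, Ring.inverse_eq_inv', Matrix.smul_apply, smul_eq_mul]
  rw [h]
  exact hsub.matrix_det.measurable.inv.mul
    ((hsub.matrix_adjugate.matrix_elem k l).measurable)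

/-- If `Y` is independent of `X`, a bound on the probability of `(x, Y) ∈ S` that is uniform in `x`
also bounds the probability of `(X, Y) ∈ S`. -/
lemma measureReal_le_of_indepFun {Ω α β : Type*} [MeasurableSpace Ω] [MeasurableSpace α]
    [MeasurableSpace β] {P : Measure Ω} [IsProbabilityMeasure P] {X : Ω → α} {Y : Ω → β}
    (hXY : IndepFun X Y P) (hX : Measurable X) (hY : Measurable Y) {S : Set (α × β)}
    (hS : MeasurableSet S) {ε : ℝ} (hε : 0 ≤ ε) (h : ∀ x, P.real {ω | (x, Y ω) ∈ S} ≤ ε) :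
    P.real {ω | (X ω, Y ω) ∈ S} ≤ ε := by
  have := Measure.isProbabilityMeasure_map (μ := P) hX.aemeasurable
  have := Measure.isProbabilityMeasure_map (μ := P) hY.aemeasurable
  have h1 : P {ω | (X ω, Y ω) ∈ S} = ((P.map X).prod (P.map Y)) S := by
    rw [← hXY.map_prod_eq_prod_map_map hX.aemeasurable hY.aemeasurable,
      Measure.map_apply (hX.prodMk hY) hS]
    rfl
  refine ENNReal.toReal_le_of_le_ofReal hε ?_
  rw [h1, Measure.prod_apply hS]
  calc _ ≤ ∫⁻ _ : α, ENNReal.ofReal ε ∂(P.map X) := by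
        refine lintegral_mono fun x => ?_
        rw [Measure.map_apply hY (measurable_prodMk_left hS)]
        refine (ENNReal.ofReal_toReal (measure_ne_top P _)).symm.trans_le ?_
        exact ENNReal.ofReal_le_ofReal (h x)
    _ = ENNReal.ofReal ε := by simp

/-- Markov's inequality for a weighted sum of indicator functions. -/
lemma measureReal_sum_indicator_le {Ω ι : Type*} [MeasurableSpace Ω] {P : Measure Ω}
    [IsProbabilityMeasure P] (s : Finset ι) {a : ι → ℝ} (ha : ∀ i ∈ s, 0 ≤ a i) {B : ι → Set Ω}
    (hB : ∀ i ∈ s, MeasurableSet (B i)) {t : ℝ} (ht : 0 < t) :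
    P.real {ω | t ≤ ∑ i ∈ s, a i * (B i).indicator (fun _ => 1) ω}
      ≤ (∑ i ∈ s, a i * P.real (B i)) / t := by
  have hint : ∀ i ∈ s, Integrable (fun ω => a i * (B i).indicator (fun _ => (1 : ℝ)) ω) P :=
    fun i hi => ((integrable_const _).indicator (hB i hi)).const_mul _
  have h := mul_meas_ge_le_integral_of_nonneg (μ := P)
    (f := fun ω => ∑ i ∈ s, a i * (B i).indicator (fun _ => (1 : ℝ)) ω)
    (ae_of_all _ fun ω => Finset.sum_nonneg fun i hi =>
      mul_nonneg (ha i hi) (Set.indicator_nonneg (fun _ _ => zero_le_one) _))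
    (integrable_finsetSum _ hint) t
  rw [integral_finsetSum _ hint] at h
  rw [le_div_iff₀ ht, mul_comm]
  refine h.trans (le_of_eq (Finset.sum_congr rfl fun i hi => ?_))
  rw [integral_const_mul, integral_indicator (hB i hi)]
  simp

/-- Summation over the dyadic scales coarser than a given one costs only a constant in the
stretched exponential bounds. -/
lemma exists_sum_scales_le (b : ℝ) {a : ℝ} (ha : 0 < a) :
    ∃ S : ℝ, 0 < S ∧ ∀ (Q : ℝ) (k : ℕ), 1 ≤ Q / 2 ^ k →
      ∑ l ∈ Finset.range (k + 1), ((2 : ℝ) ^ (k - l)) ^ b * Real.exp (-a * √(Q / 2 ^ l))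
        ≤ S * Real.exp (-(a / 2) * √(Q / 2 ^ k)) := by
  set f : ℕ → ℝ := fun i => ((2 : ℝ) ^ i) ^ b * Real.exp (-(a / 2) * √(2 ^ i)) with hf
  have hf0 : ∀ i, 0 ≤ f i := fun i => by positivity
  have hsummable : Summable f := by
    have hlim := (tendsto_rpow_mul_exp_neg_mul_atTop_nhds_zero (2 * (b + 1)) (a / 2)
      (by positivity)).comp (Real.tendsto_sqrt_atTop.comp
        (tendsto_pow_atTop_atTop_of_one_lt (one_lt_two : (1 : ℝ) < 2)))
    obtain ⟨K, hK⟩ := hlim.bddAbove_range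
    refine Summable.of_nonneg_of_le hf0 (fun i => ?_) (summable_geometric_two.mul_left K)
    have h1 := hK ⟨i, rfl⟩
    simp only [Function.comp_apply] at h1
    have h2 : (√((2 : ℝ) ^ i)) ^ (2 * (b + 1)) = ((2 : ℝ) ^ i) ^ b * 2 ^ i := by
      rw [Real.rpow_mul (Real.sqrt_nonneg _), Real.rpow_two, Real.sq_sqrt (by positivity),
        Real.rpow_add (by positivity), Real.rpow_one]
    rw [h2] at h1
    rw [one_div, inv_pow, ← div_eq_mul_inv, le_div_iff₀ (by positivity)]
    calc f i * 2 ^ i = ((2 : ℝ) ^ i) ^ b * 2 ^ i * Real.exp (-(a / 2) * √(2 ^ i)) := by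
          rw [hf]; ring
      _ ≤ K := h1
  refine ⟨∑' i, f i + 1, by
    have : 0 ≤ ∑' i, f i := tsum_nonneg hf0
    linarith, fun Q k hQ => ?_⟩
  have hterm : ∀ l ∈ Finset.range (k + 1),
      ((2 : ℝ) ^ (k - l)) ^ b * Real.exp (-a * √(Q / 2 ^ l))
        ≤ f (k - l) * Real.exp (-(a / 2) * √(Q / 2 ^ k)) := by
    intro l hl
    have hlk : l ≤ k := Nat.lt_succ_iff.mp (Finset.mem_range.mp hl)
    have h1 : Q / 2 ^ l = 2 ^ (k - l) * (Q / 2 ^ k) := by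
      rw [pow_sub₀ _ two_ne_zero hlk]
      field_simp
    have h2 : 1 ≤ √((2 : ℝ) ^ (k - l)) := Real.one_le_sqrt.mpr (one_le_pow₀ one_le_two)
    have h3 : 1 ≤ √(Q / 2 ^ k) := Real.one_le_sqrt.mpr hQ
    rw [hf, mul_assoc, ← Real.exp_add, h1, Real.sqrt_mul (by positivity)]
    gcongr
    -- for `x, y ≥ 1` one has `x + y ≤ 2 x y`
    nlinarith [mul_nonneg (sub_nonneg.mpr h2) (sub_nonneg.mpr h3),
      mul_le_mul h2 h3 zero_le_one (zero_le_one.trans h2)]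
  calc _ ≤ ∑ l ∈ Finset.range (k + 1), f (k - l) * Real.exp (-(a / 2) * √(Q / 2 ^ k)) :=
        Finset.sum_le_sum hterm
    _ = (∑ l ∈ Finset.range (k + 1), f l) * Real.exp (-(a / 2) * √(Q / 2 ^ k)) := by
        rw [← Finset.sum_mul, Finset.sum_flip]
    _ ≤ _ := by
        gcongr
        have := hsummable.sum_le_tsum (Finset.range (k + 1)) fun i _ => hf0 i
        linarith

/-- The properties of Wigner matrices used in the argument: every column is independent of the
corresponding minor, quadratic forms in the column concentrate, and the diagonal entries are
small. -/
structure IsWignerLike {Ω : Type*} [MeasurableSpace Ω] (P : Measure Ω)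
    (H : Ω → Matrix (Fin N) (Fin N) ℂ) (C c : ℝ) : Prop where
  isHermitian : ∀ ω, (H ω).IsHermitian
  measurable : ∀ k l, Measurable fun ω => H ω k l
  indep : ∀ j, IndepFun (fun ω (k l : Fin N) => minor (H ω) j k l) (fun ω => offCol (H ω) j) P
  quad : ∀ (j : Fin N) (A : Matrix (Fin N) (Fin N) ℂ) (r t : ℝ), 0 < r → 0 ≤ t →
    ∑ k, ∑ l, Complex.normSq (A k l) ≤ r ^ 2 →
      P.real {ω | t ≤ ‖quadForm A (offCol (H ω) j) - offTrace A j / N‖}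
        ≤ C * Real.exp (-c * (t * N) / r)
  diag : ∀ (j : Fin N) (t : ℝ), 0 ≤ t → P.real {ω | t ≤ ‖H ω j j‖} ≤ C * Real.exp (-c * t * √N)

section Model

variable {Ω : Type*} [MeasurableSpace Ω] {P : Measure Ω} [IsProbabilityMeasure P]
  {H : Ω → Matrix (Fin N) (Fin N) ℂ} {C c : ℝ} (hW : IsWignerLike P H C c)
include hW

omit [IsProbabilityMeasure P] in
lemma IsWignerLike.measurable_resolvent (z : ℂ) (k l : Fin N) :
    Measurable fun ω => resolvent (H ω) z k l :=
  (measurable_resolvent_apply z k l).comp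
    (measurable_pi_lambda _ fun i => measurable_pi_lambda _ fun j => hW.measurable i j)

omit [IsProbabilityMeasure P] in
lemma IsWignerLike.measurable_minor (j : Fin N) :
    Measurable fun ω (k l : Fin N) => minor (H ω) j k l := by
  refine measurable_pi_lambda _ fun k => measurable_pi_lambda _ fun l => ?_
  simp only [minor, Matrix.of_apply]
  split_ifs
  · exact measurable_const
  · exact hW.measurable k l

omit [IsProbabilityMeasure P] in
lemma IsWignerLike.measurable_offCol (j : Fin N) : Measurable fun ω => offCol (H ω) j := by
  refine measurable_pi_lambda _ fun k => ?_
  simp only [offCol]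
  split_ifs
  · exact measurable_const
  · exact hW.measurable k j

omit hW [IsProbabilityMeasure P] in
lemma measurable_quadForm_sub {A : Ω → Matrix (Fin N) (Fin N) ℂ} {a : Ω → Fin N → ℂ} (z : ℂ)
    (hA : ∀ k l, Measurable fun ω => resolvent (A ω) z k l) (ha : ∀ k, Measurable fun ω => a ω k)
    (j : Fin N) : Measurable fun ω =>
      quadForm (resolvent (A ω) z) (a ω) - offTrace (resolvent (A ω) z) j / N := by
  unfold quadForm offTrace
  refine Measurable.sub (Finset.measurable_sum _ fun k _ => Finset.measurable_sum _ fun l _ => ?_)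
    (Measurable.div_const (Finset.measurable_sum _ fun k _ => ?_) _)
  · exact ((Complex.continuous_conj.measurable.comp (ha k)).mul (hA k l)).mul (ha l)
  · split_ifs
    · exact measurable_const
    · exact hA k k

omit [IsProbabilityMeasure P] in
lemma IsWignerLike.measurableSet_isBadRow (δ : ℝ) (z : ℂ) (j : Fin N) :
    MeasurableSet {ω | IsBadRow δ (H ω) z j} := by
  have hr : ∀ k l, Measurable fun ω => resolvent (minor (H ω) j) z k l := fun k l =>
    (measurable_resolvent_apply z k l).comp (hW.measurable_minor j)
  have h1 : Measurable fun ω => (resolvent (minor (H ω) j) z).trace.im := by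
    simp only [Matrix.trace, Matrix.diag_apply]
    exact Complex.measurable_im.comp (Finset.measurable_sum _ fun k _ => hr k k)
  have h2 : Measurable fun ω => quadForm (resolvent (minor (H ω) j) z) (offCol (H ω) j)
      - offTrace (resolvent (minor (H ω) j) z) j / N :=
    measurable_quadForm_sub z hr (fun k => (measurable_pi_apply k).comp (hW.measurable_offCol j)) j
  have hset : {ω | IsBadRow δ (H ω) z j} = {ω | (resolvent (minor (H ω) j) z).trace.im ≤ 9 * N} ∩
      ({ω | δ ≤ ‖H ω j j‖} ∪ {ω | δ ≤ ‖quadForm (resolvent (minor (H ω) j) z) (offCol (H ω) j)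
        - offTrace (resolvent (minor (H ω) j) z) j / N‖}) := by
    ext ω
    simp only [IsBadRow, Set.mem_inter_iff, Set.mem_union, Set.mem_ofPred_eq]
  rw [hset]
  exact (measurableSet_le h1 measurable_const).inter
    ((measurableSet_le measurable_const (hW.measurable j j).norm).union
      (measurableSet_le measurable_const h2.norm))

/-- Bad rows are unlikely: conditionally on the minor, the quadratic form concentrates. -/
lemma IsWignerLike.measureReal_isBadRow_le (hC : 0 < C) (hc : 0 < c) {δ : ℝ} (hδ : 0 < δ) {z : ℂ}
    (hz : 0 < z.im) (hz1 : z.im ≤ 1) (j : Fin N) :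
    P.real {ω | IsBadRow δ (H ω) z j} ≤ 2 * C * Real.exp (-(c * δ / 3) * √(N * z.im)) := by
  have hN : (0 : ℝ) < N := by exact_mod_cast j.pos
  set r : ℝ := 3 * √(N / z.im) with hr
  have hr0 : 0 < r := by positivity
  have hr2 : r ^ 2 = 9 * N / z.im := by
    rw [hr, mul_pow, Real.sq_sqrt (by positivity)]; ring
  set S : Set ((Fin N → Fin N → ℂ) × (Fin N → ℂ)) :=
    {p | ∑ k, ∑ l, Complex.normSq (resolvent (Matrix.of p.1) z k l) ≤ r ^ 2 ∧
      δ ≤ ‖quadForm (resolvent (Matrix.of p.1) z) p.2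
        - offTrace (resolvent (Matrix.of p.1) z) j / N‖} with hS
  have hSm : MeasurableSet S := by
    have hr : ∀ k l, Measurable fun p : (Fin N → Fin N → ℂ) × (Fin N → ℂ) =>
        resolvent (Matrix.of p.1) z k l := fun k l =>
      (measurable_resolvent_apply z k l).comp measurable_fst
    have hm : Measurable fun p : (Fin N → Fin N → ℂ) × (Fin N → ℂ) =>
        ∑ k, ∑ l, Complex.normSq (resolvent (Matrix.of p.1) z k l) :=
      Finset.measurable_sum _ fun k _ => Finset.measurable_sum _ fun l _ =>
        Complex.continuous_normSq.measurable.comp (hr k l)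
    exact (measurableSet_le hm measurable_const).inter
      (measurableSet_le measurable_const (measurable_quadForm_sub z hr
        (fun k => (measurable_pi_apply k).comp measurable_snd) j).norm)
  have hexp : -c * (δ * N) / r = -(c * δ / 3) * √(N * z.im) := by
    have h1 : √(N * z.im) = z.im * √(N / z.im) := by
      rw [show (N : ℝ) * z.im = z.im ^ 2 * (N / z.im) by field_simp,
        Real.sqrt_mul (by positivity), Real.sqrt_sq hz.le]
    have h2 : (N : ℝ) = z.im * √(N / z.im) ^ 2 := by
      rw [Real.sq_sqrt (by positivity)]; field_simp
    rw [h1, hr, div_eq_iff (by positivity)]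
    linear_combination (-c * δ) * h2
  have hprob : P.real {ω | ((fun k l => minor (H ω) j k l), offCol (H ω) j) ∈ S}
      ≤ C * Real.exp (-(c * δ / 3) * √(N * z.im)) := by
    refine measureReal_le_of_indepFun (hW.indep j) (hW.measurable_minor j) (hW.measurable_offCol j)
      hSm (by positivity) fun A => ?_
    by_cases hA : ∑ k, ∑ l, Complex.normSq (resolvent (Matrix.of A) z k l) ≤ r ^ 2
    · rw [← hexp]
      refine le_trans (measureReal_mono fun ω hω => ?_)
        (hW.quad j (resolvent (Matrix.of A) z) r δ hr0 hδ.le hA)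
      exact hω.2
    · have : {ω | (A, offCol (H ω) j) ∈ S} = ∅ := by
        refine Set.eq_empty_of_forall_notMem fun ω hω => hA hω.1
      rw [this, measureReal_empty]
      positivity
  have hincl : {ω | IsBadRow δ (H ω) z j} ⊆ {ω | δ ≤ ‖H ω j j‖}
      ∪ {ω | ((fun k l => minor (H ω) j k l), offCol (H ω) j) ∈ S} := by
    rintro ω ⟨h1, h2 | h2⟩
    · exact Or.inl h2
    · refine Or.inr ⟨?_, h2⟩
      have h3 := sum_normSq_resolvent (isHermitian_minor (hW.isHermitian ω) j) hz
      refine le_of_eq_of_le h3 ?_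
      rw [hr2]
      gcongr
  have hdiag := hW.diag j δ hδ.le
  calc _ ≤ _ := measureReal_mono hincl
    _ ≤ _ := measureReal_union_le _ _
    _ ≤ C * Real.exp (-(c * δ / 3) * √(N * z.im)) + C * Real.exp (-(c * δ / 3) * √(N * z.im)) := by
        refine add_le_add (hdiag.trans ?_) hprob
        refine mul_le_mul_of_nonneg_left (Real.exp_le_exp.mpr ?_) hC.le
        have h1 : √(N * z.im) ≤ √N := Real.sqrt_le_sqrt (by nlinarith)
        have h2 : c * δ / 3 * √(N * z.im) ≤ c * δ * √N := by
          have : 0 ≤ √(N : ℝ) := Real.sqrt_nonneg _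
          have h5 : c * δ / 3 * √(N * z.im) ≤ c * δ / 3 * √N := by gcongr
          nlinarith [mul_nonneg (mul_pos hc hδ).le this]
        linarith
    _ = _ := by ring

end Model

/-- Diagonal resolvent entries at scale `η ≥ Q₀ / N` are bounded, except with probability
exponentially small in `√(N η)`. -/
theorem exists_resolvent_tail {E C c : ℝ} (hE : |E| < 2) (hC : 0 < C) (hc : 0 < c) :
    ∃ C₁ C' c' Q₀ : ℝ, 1 ≤ C₁ ∧ 0 < C' ∧ 0 < c' ∧ 1 ≤ Q₀ ∧
      ∀ (N : ℕ) (Ω : Type*) [MeasurableSpace Ω] (P : Measure Ω) [IsProbabilityMeasure P]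
        (H : Ω → Matrix (Fin N) (Fin N) ℂ), IsWignerLike P H C c →
        ∀ k : ℕ, Q₀ ≤ N / 2 ^ k → ∀ j : Fin N,
          P.real {ω | C₁ < ‖resolvent (H ω) (scalePt E k) j j‖}
            ≤ C' * Real.exp (-c' * √(N / 2 ^ k)) := by
  obtain ⟨c₀, hc₀, hc₀E⟩ : ∃ c₀ : ℝ, 0 < c₀ ∧ 8 * c₀ ^ 2 = 4 - E ^ 2 := by
    have hE2 : 0 < 4 - E ^ 2 := by
      have := sq_lt_sq' (neg_lt_of_abs_lt hE) (lt_of_abs_lt hE)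
      linarith
    exact ⟨√((4 - E ^ 2) / 8), Real.sqrt_pos.mpr (by positivity), by
      rw [Real.sq_sqrt (by positivity)]; ring⟩
  have hcsq : c₀ ^ 2 ≤ 1 / 2 := by nlinarith [sq_nonneg E]
  have hc1 : c₀ ≤ 1 := by nlinarith
  set δ : ℝ := c₀ ^ 4 / 336 with hδ
  have hδ0 : 0 < δ := by positivity
  have hδ1 : δ ≤ 1 := by
    have : c₀ ^ 4 ≤ 1 := pow_le_one₀ hc₀.le hc1
    rw [hδ]; linarith
  set a : ℝ := c * δ / 3 with ha
  have ha0 : 0 < a := by positivity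
  obtain ⟨S, hS, hsum⟩ := exists_sum_scales_le 1 ha0
  obtain ⟨S', hS', hsum'⟩ := exists_sum_scales_le 0 (half_pos ha0)
  set K : ℝ := 2 * (4 / c₀) * (2 * C) * S * (28 / c₀ ^ 2) with hK
  have hK0 : 0 < K := by positivity
  refine ⟨4 / c₀, K * S' + 2 * C, a / 2 / 2, 1 / δ, ?_, by positivity, by positivity, ?_, ?_⟩
  · rw [le_div_iff₀ hc₀]; linarith
  · rw [le_div_iff₀ hδ0]; linarith
  intro N Ω _ P _ H hW k hk j
  have hN : (0 : ℝ) < N := by exact_mod_cast j.pos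
  have hscale : ∀ l, l ≤ k → 1 / δ ≤ (N : ℝ) / 2 ^ l := fun l hl => by
    refine hk.trans ?_
    gcongr
    norm_num
  have hone : ∀ l, l ≤ k → 1 ≤ (N : ℝ) / 2 ^ l := fun l hl =>
    le_trans (by rw [le_div_iff₀ hδ0]; linarith) (hscale l hl)
  have hbad : ∀ (l : ℕ) (i : Fin N), P.real {ω | IsBadRow δ (H ω) (scalePt E l) i}
      ≤ 2 * C * Real.exp (-a * √(N / 2 ^ l)) := by
    intro l i
    have hz1 : (scalePt E l).im ≤ 1 := by
      rw [scalePt_im]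
      exact div_le_one_of_le₀ (one_le_pow₀ (by norm_num)) (by positivity)
    have := hW.measureReal_isBadRow_le hC hc hδ0 (scalePt_im_pos E l) hz1 i
    rwa [scalePt_im, mul_one_div] at this
  -- the event that the average overflow is too large at scale `l`, controlled by Markov's inequality
  set F : ℕ → Set Ω := fun l => {ω | c₀ ^ 2 / 28 ≤
      (∑ i, overflow (4 / c₀) (fun m => IsBadRow δ (H ω) (scalePt E m) i) l) / N} with hF
  have hFle : ∀ l, l ≤ k → P.real (F l) ≤ K * Real.exp (-(a / 2) * √(N / 2 ^ l)) := by
    intro l hl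
    set B : Fin N × ℕ → Set Ω := fun q => {ω | IsBadRow δ (H ω) (scalePt E (q.2 + 1)) q.1} with hB
    set A : Fin N × ℕ → ℝ := fun q => 2 ^ (l - q.2) * (4 / c₀) / N with hA
    have hFeq : F l = {ω | c₀ ^ 2 / 28 ≤ ∑ q ∈ (univ : Finset (Fin N)) ×ˢ Finset.range l,
        A q * (B q).indicator (fun _ => 1) ω} := by
      ext ω
      simp only [hF, Set.mem_ofPred_eq]
      rw [Finset.sum_product, Finset.sum_div]
      refine iff_of_eq (congrArg _ (Finset.sum_congr rfl fun i _ => ?_))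
      rw [overflow, Finset.sum_div]
      refine Finset.sum_congr rfl fun m _ => ?_
      classical
      rw [Set.indicator_apply]
      simp only [hA, hB, Set.mem_ofPred_eq]
      split_ifs <;> ring
    rw [hFeq]
    refine (measureReal_sum_indicator_le _ (fun q _ => by positivity)
      (fun q _ => hW.measurableSet_isBadRow δ _ _) (by positivity)).trans ?_
    have h1 : ∑ q ∈ (univ : Finset (Fin N)) ×ˢ Finset.range l, A q * P.real (B q)
        ≤ 2 * (4 / c₀) * (2 * C) * (S * Real.exp (-(a / 2) * √(N / 2 ^ l))) := by
      calc ∑ q ∈ (univ : Finset (Fin N)) ×ˢ Finset.range l, A q * P.real (B q)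
          ≤ ∑ q ∈ (univ : Finset (Fin N)) ×ˢ Finset.range l,
              A q * (2 * C * Real.exp (-a * √(N / 2 ^ (q.2 + 1)))) :=
            Finset.sum_le_sum fun q _ => by
              gcongr
              exact hbad _ _
        _ = ∑ m ∈ Finset.range l, 2 * (4 / c₀) * (2 * C) * (((2 : ℝ) ^ (l - (m + 1))) ^ (1 : ℝ)
              * Real.exp (-a * √(N / 2 ^ (m + 1)))) := by
            simp only [hA]
            rw [Finset.sum_product]
            dsimp only
            rw [Finset.sum_const, Finset.card_univ, Fintype.card_fin,
              nsmul_eq_mul, Finset.mul_sum]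
            refine Finset.sum_congr rfl fun m hm => ?_
            have h2 : l - m = (l - (m + 1)) + 1 := by
              have := Finset.mem_range.mp hm
              omega
            rw [h2, pow_succ, Real.rpow_one]
            field_simp
        _ ≤ _ := by
            rw [← Finset.mul_sum]
            gcongr
            refine le_trans ?_ (hsum N l (hone l hl))
            rw [Finset.sum_range_succ' _ l]
            have : 0 ≤ ((2 : ℝ) ^ (l - 0)) ^ (1 : ℝ) * Real.exp (-a * √(N / 2 ^ 0)) := by positivity
            linarith
    calc _ ≤ 2 * (4 / c₀) * (2 * C) * (S * Real.exp (-(a / 2) * √(N / 2 ^ l))) / (c₀ ^ 2 / 28) := by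
          gcongr
      _ = _ := by rw [hK]; field_simp
  -- outside all of these events only a bad row at the last scale can make the entry large
  have hincl : {ω | 4 / c₀ < ‖resolvent (H ω) (scalePt E k) j j‖}
      ⊆ (⋃ l ∈ Finset.range (k + 1), F l) ∪ {ω | IsBadRow δ (H ω) (scalePt E k) j} := by
    intro ω hω
    simp only [Set.mem_union, Set.mem_iUnion, Set.mem_ofPred_eq] at hω ⊢
    by_contra! hcon
    obtain ⟨h1, h2⟩ := hcon
    refine absurd (norm_resolvent_le_of_overflow_le (hW.isHermitian ω) hc₀ hc₀E hδ0 ?_ ?_ ?_ h2)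
      (not_le.mpr hω)
    · rw [hδ]; linarith
    · rw [div_le_iff₀ hδ0] at hk
      linarith
    · intro l hl
      have h3 := h1 l (Finset.mem_range.mpr (by omega))
      simp only [hF, Set.mem_ofPred_eq, not_le] at h3
      exact h3.le
  have hF' : ∑ l ∈ Finset.range (k + 1), P.real (F l)
      ≤ K * (S' * Real.exp (-(a / 2 / 2) * √(N / 2 ^ k))) := by
    calc _ ≤ ∑ l ∈ Finset.range (k + 1), K * (((2 : ℝ) ^ (k - l)) ^ (0 : ℝ)
          * Real.exp (-(a / 2) * √(N / 2 ^ l))) :=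
          Finset.sum_le_sum fun l hl => by
            rw [Real.rpow_zero, one_mul]
            exact hFle l (Nat.lt_succ_iff.mp (Finset.mem_range.mp hl))
      _ ≤ _ := by
          rw [← Finset.mul_sum]
          gcongr
          exact hsum' N k (hone k le_rfl)
  calc _ ≤ _ := measureReal_mono hincl
    _ ≤ _ := measureReal_union_le _ _
    _ ≤ K * (S' * Real.exp (-(a / 2 / 2) * √(N / 2 ^ k)))
        + 2 * C * Real.exp (-(a / 2 / 2) * √(N / 2 ^ k)) := by
        refine add_le_add ((measureReal_biUnion_finset_le _ _).trans hF') ((hbad k j).trans ?_)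
        gcongr
        linarith
    _ = _ := by ring

/-! ### Delocalization of eigenvectors -/

lemma sum_normSq_of_ellNorm_two {v : Fin N → ℂ} (h : ellNorm 2 v = 1) :
    ∑ k, Complex.normSq (v k) = 1 := by
  have h2 : (ENNReal.ofReal 2).toReal = 2 := by simp
  rw [ellNorm, PiLp.norm_eq_sum (by rw [h2]; norm_num), h2] at h
  simp only [Real.rpow_ofNat] at h
  have h0 : 0 ≤ ∑ k, ‖v k‖ ^ 2 := Finset.sum_nonneg fun k _ => sq_nonneg _
  simp only [Complex.normSq_eq_norm_sq]
  have h3 := congrArg (fun t : ℝ => t ^ (2 : ℝ)) h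
  simp only [Real.one_rpow] at h3
  rwa [← Real.rpow_mul h0, one_div, inv_mul_cancel₀ two_ne_zero, Real.rpow_one] at h3

/-- The lower bound on the `ℓᵖ` norm in terms of the rescaled squared coordinates. -/
lemma le_sum_rpow_of_ellNorm {v : Fin N → ℂ} {p M : ℝ} (hp : 0 < p) (hM : 0 ≤ M) (hN : 0 < N)
    (h : M * (N : ℝ) ^ (-(1 / 2) + 1 / p : ℝ) ≤ ellNorm p v) :
    N * M ^ p ≤ ∑ k, (N * Complex.normSq (v k)) ^ (p / 2) := by
  have hN' : (0 : ℝ) < N := by exact_mod_cast hN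
  have hp' : (ENNReal.ofReal p).toReal = p := ENNReal.toReal_ofReal hp.le
  rw [ellNorm, PiLp.norm_eq_sum (by rw [hp']; exact hp), hp'] at h
  simp only at h
  have h0 : 0 ≤ ∑ k, ‖v k‖ ^ p := Finset.sum_nonneg fun k _ => by positivity
  have h1 := Real.rpow_le_rpow (by positivity) h hp.le
  rw [← Real.rpow_mul h0, one_div_mul_cancel hp.ne', Real.rpow_one,
    Real.mul_rpow hM (by positivity), ← Real.rpow_mul hN'.le] at h1
  have h2 : ∀ k, (N * Complex.normSq (v k)) ^ (p / 2) = (N : ℝ) ^ (p / 2) * ‖v k‖ ^ p := by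
    intro k
    rw [Real.mul_rpow hN'.le (Complex.normSq_nonneg _), Complex.normSq_eq_norm_sq,
      ← Real.rpow_two, ← Real.rpow_mul (norm_nonneg _), mul_div_cancel₀ _ two_ne_zero]
  simp_rw [h2]
  rw [← Finset.mul_sum]
  calc N * M ^ p = (N : ℝ) ^ (p / 2) * (M ^ p * (N : ℝ) ^ ((-(1 / 2) + 1 / p) * p)) := by
        have : (N : ℝ) ^ (p / 2) * (N : ℝ) ^ ((-(1 / 2) + 1 / p) * p) = N := by
          rw [← Real.rpow_add hN']
          have : p / 2 + (-(1 / 2) + 1 / p) * p = 1 := by field_simp; ring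
          rw [this, Real.rpow_one]
        linear_combination (-M ^ p) * this
    _ ≤ _ := by gcongr

lemma div_four_rpow_le {p M : ℝ} (hp : 2 < p) (hM : 0 ≤ M) :
    (M ^ 2 / 4) ^ (p / 2) ≤ M ^ p / 2 := by
  have h1 : M ^ 2 / 4 = (M / 2) ^ (2 : ℝ) := by rw [Real.rpow_two]; ring
  rw [h1, ← Real.rpow_mul (by positivity), mul_div_cancel₀ _ two_ne_zero,
    Real.div_rpow hM (by norm_num)]
  gcongr
  calc (2 : ℝ) = 2 ^ (1 : ℝ) := by simp
    _ ≤ 2 ^ p := Real.rpow_le_rpow_of_exponent_le (by norm_num) (by linarith)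

/-- If `H` has a localized eigenvector then many diagonal resolvent entries are large, with larger
weight given to the coarser scales. -/
lemma localized_le_sum {H : Matrix (Fin N) (Fin N) ℂ} (hH : H.IsHermitian) {E K p M C₁ : ℝ}
    (hp : 2 < p) (hM : 0 ≤ M) (hN : 0 < N) (hC₁ : 1 ≤ C₁) {k : ℕ}
    (hK : ∀ l, l ≤ k → K ≤ N / 2 ^ l) (hk : (N : ℝ) / 2 ^ k ≤ M ^ 2 / (8 * C₁))
    (h : HasLocalizedEigenvector H E K p M) :
    N * M ^ p / 2 ≤ ∑ q ∈ (univ : Finset (Fin N)) ×ˢ Finset.range (k + 1),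
      (4 * C₁ * (N / 2 ^ q.2)) ^ (p / 2)
        * {q : Fin N × ℕ | C₁ < ‖resolvent H (scalePt E q.2) q.1 q.1‖}.indicator (fun _ => 1) q := by
  classical
  obtain ⟨v, lam, hv, hlam, hv2, hvp⟩ := h
  have hN' : (0 : ℝ) < N := by exact_mod_cast hN
  have hC0 : 0 < C₁ := by linarith
  have hnorm := sum_normSq_of_ellNorm_two hv2
  have hsum := le_sum_rpow_of_ellNorm (by linarith) hM hN hvp
  set y : Fin N → ℝ := fun j => N * Complex.normSq (v j) with hy
  have hy0 : ∀ j, 0 ≤ y j := fun j => mul_nonneg hN'.le (Complex.normSq_nonneg _)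
  have hyN : ∀ j, y j ≤ N := fun j => by
    have := Finset.single_le_sum (f := fun k => Complex.normSq (v k))
      (fun _ _ => Complex.normSq_nonneg _) (Finset.mem_univ j)
    rw [hnorm] at this
    simp only [hy]
    nlinarith
  have hgood : ∀ j l, l ≤ k → ¬ C₁ < ‖resolvent H (scalePt E l) j j‖ →
      y j ≤ 2 * C₁ * (N / 2 ^ l) := by
    intro j l hl hle
    have hz := scalePt_im_pos E l
    have h1 : |lam - (scalePt E l).re| ≤ (scalePt E l).im := by
      refine hlam.trans ?_
      rw [scalePt_im, div_le_div_iff₀ hN' (by positivity), one_mul]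
      have := hK l hl
      rwa [le_div_iff₀ (by positivity)] at this
    have h2 := normSq_eigenvector_le hH hz hv hnorm h1 j
    have h3 : (resolvent H (scalePt E l) j j).im ≤ C₁ :=
      (Complex.im_le_norm _).trans (not_lt.mp hle)
    calc y j ≤ N * (2 * (scalePt E l).im * C₁) := by
          simp only [hy]
          gcongr
          exact h2.trans (by gcongr)
      _ = _ := by rw [scalePt_im]; ring
  set f : Fin N → ℕ → ℝ := fun j l => (4 * C₁ * (N / 2 ^ l)) ^ (p / 2)
        * {q : Fin N × ℕ | C₁ < ‖resolvent H (scalePt E q.2) q.1 q.1‖}.indicator (fun _ => 1) (j, l)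
    with hf
  have hf0 : ∀ j l, 0 ≤ f j l := fun j l =>
    mul_nonneg (by positivity) (Set.indicator_nonneg (fun _ _ => zero_le_one) _)
  have hrow : ∀ j, y j ^ (p / 2) ≤ M ^ p / 2 + ∑ l ∈ Finset.range (k + 1), f j l := by
    intro j
    have hs0 : 0 ≤ ∑ l ∈ Finset.range (k + 1), f j l := Finset.sum_nonneg fun l _ => hf0 j l
    by_cases hex : ∃ l, l ≤ k ∧ 2 * C₁ * (N / 2 ^ l) < y j
    · -- the coarsest scale at which the coordinate is too large
      set l := Nat.find hex with hl
      obtain ⟨hlk, hly⟩ : l ≤ k ∧ 2 * C₁ * (N / 2 ^ l) < y j := Nat.find_spec hex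
      have hbad : C₁ < ‖resolvent H (scalePt E l) j j‖ := by
        by_contra hcon
        exact absurd (hgood j l hlk hcon) (not_le.mpr hly)
      have hup : y j ≤ 4 * C₁ * (N / 2 ^ l) := by
        rcases Nat.eq_zero_or_pos l with h0 | h0
        · rw [h0, pow_zero, div_one]
          have := hyN j
          nlinarith
        · have hmin := Nat.find_min hex (m := l - 1) (by omega)
          push Not at hmin
          refine (hmin (by omega)).trans (le_of_eq ?_)
          obtain ⟨i, hi⟩ := Nat.exists_eq_succ_of_ne_zero h0.ne'
          rw [hi, Nat.succ_sub_one, pow_succ]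
          field_simp
          norm_num
      have h1 : f j l ≤ ∑ l ∈ Finset.range (k + 1), f j l :=
        Finset.single_le_sum (fun l _ => hf0 j l) (Finset.mem_range.mpr (by omega))
      have h2 : f j l = (4 * C₁ * (N / 2 ^ l)) ^ (p / 2) := by
        simp only [hf]
        rw [Set.indicator_of_mem (by simpa using hbad), mul_one]
      have h3 : y j ^ (p / 2) ≤ f j l := by
        rw [h2]
        exact Real.rpow_le_rpow (hy0 j) hup (by linarith)
      have h4 : 0 ≤ M ^ p / 2 := by positivity
      linarith
    · push Not at hex
      have h1 : y j ≤ M ^ 2 / 4 := by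
        refine (hex k le_rfl).trans ?_
        calc 2 * C₁ * (N / 2 ^ k) ≤ 2 * C₁ * (M ^ 2 / (8 * C₁)) := by gcongr
          _ = M ^ 2 / 4 := by field_simp; ring
      have := (Real.rpow_le_rpow (hy0 j) h1 (by linarith : 0 ≤ p / 2)).trans
        (div_four_rpow_le hp hM)
      linarith
  rw [Finset.sum_product]
  have h5 : N * M ^ p ≤ ∑ j, (M ^ p / 2 + ∑ l ∈ Finset.range (k + 1), f j l) :=
    hsum.trans (Finset.sum_le_sum fun j _ => hrow j)
  rw [Finset.sum_add_distrib, Finset.sum_const, Finset.card_univ, Fintype.card_fin,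
    nsmul_eq_mul] at h5
  linarith

/-- A localized eigenvector needs more than `M² / 4` coordinates. -/
lemma not_localized_of_le {H : Matrix (Fin N) (Fin N) ℂ} {E K p M : ℝ} (hp : 2 < p) (hM : 0 < M)
    (hNM : (N : ℝ) ≤ M ^ 2 / 4) : ¬ HasLocalizedEigenvector H E K p M := by
  rintro ⟨v, lam, -, -, hv2, hvp⟩
  have hnorm := sum_normSq_of_ellNorm_two hv2
  rcases Nat.eq_zero_or_pos N with rfl | hN
  · simp at hnorm
  have hN' : (0 : ℝ) < N := by exact_mod_cast hN
  have hsum := le_sum_rpow_of_ellNorm (by linarith) hM.le hN hvp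
  have hrow : ∀ j, (N * Complex.normSq (v j)) ^ (p / 2) ≤ M ^ p / 2 := fun j => by
    refine le_trans (Real.rpow_le_rpow (mul_nonneg hN'.le (Complex.normSq_nonneg _)) ?_
      (by linarith)) (div_four_rpow_le hp hM.le)
    have := Finset.single_le_sum (f := fun k => Complex.normSq (v k))
      (fun _ _ => Complex.normSq_nonneg _) (Finset.mem_univ j)
    rw [hnorm] at this
    nlinarith
  have h1 := hsum.trans (Finset.sum_le_sum fun j _ => hrow j)
  rw [Finset.sum_const, Finset.card_univ, Fintype.card_fin, nsmul_eq_mul] at h1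
  have : 0 < N * M ^ p := by positivity
  linarith

/-- Delocalization of the bulk eigenvectors of a Wigner-like matrix. A localized eigenvector forces a
weighted count of large diagonal resolvent entries to be large, and Markov's inequality bounds the
probability of this. -/
theorem exists_delocalization {E K p C c : ℝ} (hE : |E| < 2) (hp : 2 < p) (hC : 0 < C)
    (hc : 0 < c) :
    ∃ C' c' M₀ : ℝ, 0 < C' ∧ 0 < c' ∧
      ∀ (N : ℕ) (M : ℝ), M₀ ≤ M → ∀ (Ω : Type*) [MeasurableSpace Ω] (P : Measure Ω)
        [IsProbabilityMeasure P] (H : Ω → Matrix (Fin N) (Fin N) ℂ), IsWignerLike P H C c →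
        P.real {ω | HasLocalizedEigenvector (H ω) E K p M} ≤ C' * Real.exp (-c' * √M) := by
  obtain ⟨C₁, C', c', Q₀, hC₁1, hC', hc', hQ₀, htail⟩ := exists_resolvent_tail hE hC hc
  obtain ⟨S, hS, hsum⟩ := exists_sum_scales_le (p / 2) hc'
  have hC₁ : 0 < C₁ := by linarith
  set Q₁ := max Q₀ K with hQ₁
  have hQ₁1 : 1 ≤ Q₁ := hQ₀.trans (le_max_left _ _)
  refine ⟨2 * C' * S, c' / 2 / √(16 * C₁), 16 * C₁ * Q₁, by positivity, by positivity, ?_⟩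
  intro N M hM Ω _ P _ H hW
  have hM1 : 1 ≤ M := by nlinarith
  have hM0 : 0 < M := by linarith
  rcases le_or_gt (N : ℝ) (M ^ 2 / (8 * C₁)) with hsmall | hlarge
  · have : {ω | HasLocalizedEigenvector (H ω) E K p M} = ∅ := by
      refine Set.eq_empty_of_forall_notMem fun ω hω => not_localized_of_le hp hM0 ?_ hω
      refine hsmall.trans ?_
      gcongr
      linarith
    rw [this, measureReal_empty]
    positivity
  have hN' : (0 : ℝ) < N := lt_trans (by positivity) hlarge
  have hN : 0 < N := by exact_mod_cast hN'
  have hex : ∃ k : ℕ, (N : ℝ) / 2 ^ k ≤ M ^ 2 / (8 * C₁) := by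
    obtain ⟨k, hk⟩ := pow_unbounded_of_one_lt ((N : ℝ) / (M ^ 2 / (8 * C₁))) one_lt_two
    refine ⟨k, ?_⟩
    rw [div_lt_iff₀ (by positivity)] at hk
    rw [div_le_iff₀ (by positivity)]
    linarith
  -- the coarsest scale with `N / 2ᵏ` below a small multiple of `M²`
  set k := Nat.find hex with hkdef
  have hk : (N : ℝ) / 2 ^ k ≤ M ^ 2 / (8 * C₁) := Nat.find_spec hex
  have hk0 : k ≠ 0 := by
    intro h0
    rw [h0, pow_zero, div_one] at hk
    linarith
  have hklow : M ^ 2 / (16 * C₁) ≤ (N : ℝ) / 2 ^ k := by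
    have hmin := Nat.find_min hex (m := k - 1) (by omega)
    obtain ⟨i, hi⟩ := Nat.exists_eq_succ_of_ne_zero hk0
    rw [hi, Nat.succ_sub_one] at hmin
    rw [hi, pow_succ (2 : ℝ) i, ← div_div (N : ℝ)]
    have h2 : M ^ 2 / (16 * C₁) = M ^ 2 / (8 * C₁) / 2 := by field_simp; norm_num
    rw [h2]
    linarith
  have hMQ : Q₁ ≤ M ^ 2 / (16 * C₁) := by
    rw [le_div_iff₀ (by positivity)]
    nlinarith
  have hscale : ∀ l, l ≤ k → Q₁ ≤ (N : ℝ) / 2 ^ l := fun l hl => by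
    refine (hMQ.trans hklow).trans ?_
    gcongr
    norm_num
  set A : Fin N × ℕ → ℝ := fun q => (4 * C₁ * (N / 2 ^ q.2)) ^ (p / 2) with hA
  set B : Fin N × ℕ → Set Ω := fun q => {ω | C₁ < ‖resolvent (H ω) (scalePt E q.2) q.1 q.1‖} with hB
  have hincl : {ω | HasLocalizedEigenvector (H ω) E K p M} ⊆ {ω | N * M ^ p / 2 ≤
      ∑ q ∈ (univ : Finset (Fin N)) ×ˢ Finset.range (k + 1),
        A q * (B q).indicator (fun _ => 1) ω} := by
    intro ω hω
    exact localized_le_sum (hW.isHermitian ω) hp hM0.le hN hC₁1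
      (fun l hl => (le_max_right _ _).trans (hscale l hl)) hk hω
  have hmarkov := measureReal_sum_indicator_le (P := P)
    ((univ : Finset (Fin N)) ×ˢ Finset.range (k + 1)) (a := A) (fun q _ => by positivity) (B := B)
    (fun q _ => measurableSet_lt measurable_const (hW.measurable_resolvent _ _ _).norm)
    (t := N * M ^ p / 2) (by positivity)
  have hk2 : 4 * C₁ * (N / 2 ^ k) ≤ M ^ 2 := by
    calc 4 * C₁ * (N / 2 ^ k) ≤ 4 * C₁ * (M ^ 2 / (8 * C₁)) := by gcongr
      _ = M ^ 2 / 2 := by field_simp; norm_num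
      _ ≤ M ^ 2 := by linarith [sq_nonneg M]
  have hpow : (4 * C₁ * (N / 2 ^ k)) ^ (p / 2) ≤ M ^ p := by
    refine (Real.rpow_le_rpow (by positivity) hk2 (by linarith)).trans (le_of_eq ?_)
    rw [← Real.rpow_two, ← Real.rpow_mul hM0.le, mul_div_cancel₀ _ two_ne_zero]
  have hnum : ∑ q ∈ (univ : Finset (Fin N)) ×ˢ Finset.range (k + 1), A q * P.real (B q)
      ≤ N * (C' * M ^ p * (S * Real.exp (-(c' / 2) * √(N / 2 ^ k)))) := by
    calc ∑ q ∈ (univ : Finset (Fin N)) ×ˢ Finset.range (k + 1), A q * P.real (B q)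
        ≤ ∑ q ∈ (univ : Finset (Fin N)) ×ˢ Finset.range (k + 1),
            C' * M ^ p * (((2 : ℝ) ^ (k - q.2)) ^ (p / 2) * Real.exp (-c' * √(N / 2 ^ q.2))) := by
          refine Finset.sum_le_sum fun q hq => ?_
          have hqk : q.2 ≤ k :=
            Nat.lt_succ_iff.mp (Finset.mem_range.mp (Finset.mem_product.mp hq).2)
          have h1 := htail N Ω P H hW q.2 ((le_max_left _ _).trans (hscale _ hqk)) q.1
          have h2 : 4 * C₁ * (N / 2 ^ q.2) = 4 * C₁ * (N / 2 ^ k) * 2 ^ (k - q.2) := by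
            rw [pow_sub₀ _ two_ne_zero hqk]
            field_simp
          have h3 : A q ≤ M ^ p * ((2 : ℝ) ^ (k - q.2)) ^ (p / 2) := by
            simp only [hA]
            rw [h2, Real.mul_rpow (by positivity) (by positivity)]
            gcongr
          calc A q * P.real (B q) ≤ M ^ p * ((2 : ℝ) ^ (k - q.2)) ^ (p / 2)
                * (C' * Real.exp (-c' * √(N / 2 ^ q.2))) := by gcongr
            _ = _ := by ring
      _ ≤ _ := by
          rw [Finset.sum_product]
          dsimp only
          rw [Finset.sum_const, Finset.card_univ, Fintype.card_fin, nsmul_eq_mul,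
            ← Finset.mul_sum]
          gcongr
          exact hsum N k (hQ₁1.trans (hscale k le_rfl))
  calc _ ≤ _ := measureReal_mono hincl
    _ ≤ _ := hmarkov
    _ ≤ N * (C' * M ^ p * (S * Real.exp (-(c' / 2) * √(N / 2 ^ k)))) / (N * M ^ p / 2) := by gcongr
    _ = 2 * C' * S * Real.exp (-(c' / 2) * √(N / 2 ^ k)) := by
        have : 0 < M ^ p := by positivity
        field_simp
    _ ≤ _ := by
        refine mul_le_mul_of_nonneg_left (Real.exp_le_exp.mpr ?_) (by positivity)
        have h1 : √M / √(16 * C₁) ≤ √(N / 2 ^ k) := by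
          rw [← Real.sqrt_div hM0.le]
          refine Real.sqrt_le_sqrt (le_trans ?_ hklow)
          gcongr
          nlinarith
        calc -(c' / 2) * √(N / 2 ^ k) ≤ -(c' / 2) * (√M / √(16 * C₁)) :=
              mul_le_mul_of_nonpos_left h1 (by linarith)
          _ = _ := by ring

/-! ### Symmetric and hermitian Wigner matrices -/

/-- Functions of disjoint families of independent variables are independent. Measurability with
respect to the generated `σ`-algebras spares writing the functions in terms of the families. -/
lemma indepFun_of_measurable_iSup {Ω ι α β : Type*} [MeasurableSpace Ω] {P : Measure Ω}
    [MeasurableSpace α] [MeasurableSpace β] {X : ι → Ω → ℝ} (hX : ∀ i, Measurable (X i))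
    (hind : iIndepFun X P) {S T : Set ι} (hST : Disjoint S T) {f : Ω → α} {g : Ω → β}
    (hf : Measurable[⨆ i ∈ S, MeasurableSpace.comap (X i) inferInstance] f)
    (hg : Measurable[⨆ i ∈ T, MeasurableSpace.comap (X i) inferInstance] g) : IndepFun f g P := by
  rw [IndepFun_iff_Indep]
  exact indep_of_indep_of_le (indep_iSup_of_disjoint (fun i => (hX i).comap_le) hind.iIndep hST)
    hf.comap_le hg.comap_le

lemma measurable_iSup_comap {Ω ι : Type*} {X : ι → Ω → ℝ} {S : Set ι} {i : ι} (hi : i ∈ S) :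
    Measurable[⨆ i ∈ S, MeasurableSpace.comap (X i) inferInstance] (X i) :=
  Measurable.mono (comap_measurable (X i))
    (le_iSup₂ (f := fun i (_ : i ∈ S) => MeasurableSpace.comap (X i) inferInstance) i hi) le_rfl

lemma sum_ite_ne {α : Type*} [AddCommMonoid α] (j : Fin N) (f : Fin N → α) :
    ∑ k, (if k = j then 0 else f k) = ∑ k : {k // k ≠ j}, f k := by
  rw [← Finset.sum_subtype (univ.filter fun k => k ≠ j) (by simp) f, Finset.sum_filter]
  exact Finset.sum_congr rfl fun k _ => by rw [ite_not]

/-- A law with Gaussian decay has exponential tails. -/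
lemma exists_exp_tail {ν : Measure ℝ} {s : ℝ} (hν : IsCenteredLaw ν s) {δ₀ : ℝ}
    (hδ₀ : 0 < δ₀) (hint : Integrable (fun x : ℝ => Real.exp (δ₀ * x ^ 2)) ν) :
    ∃ C : ℝ, 0 < C ∧ ∀ t : ℝ, ν.real {x | t ≤ |x|} ≤ C * Real.exp (-t) := by
  have := hν.isProbabilityMeasure
  obtain ⟨v, hv, hsub⟩ := exists_isSubgaussianLaw hδ₀ hint hν.mean_eq
  refine ⟨2 * Real.exp v, by positivity, fun t => ?_⟩
  refine measureReal_abs_ge_le measurable_id (Real.exp_pos v).le ?_ ?_ t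
  · simpa using hsub 1
  · simpa using hsub (-1)

lemma isHermitian_symmetricMatrix (x : Fin N → Fin N → ℝ) : (symmetricMatrix x).IsHermitian := by
  ext k l
  simp only [symmetricMatrix, Matrix.conjTranspose_apply, Matrix.of_apply, RCLike.star_def,
    Complex.conj_ofReal, min_comm, max_comm]

/-- The pair of indices of the entry `{j, k}` on or above the diagonal. -/
def upperPair (j k : Fin N) : {q : Fin N × Fin N // q.1 ≤ q.2} := ⟨(min j k, max j k), min_le_max⟩

lemma upperPair_injective (j : Fin N) :
    Function.Injective fun k : {k // k ≠ j} => upperPair k.1 j := by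
  intro k l h
  have h1 : min k.1 j = min l.1 j := congrArg (fun q => q.1.1) h
  have h2 : max k.1 j = max l.1 j := congrArg (fun q => q.1.2) h
  apply Subtype.ext
  rcases lt_or_gt_of_ne k.2 with h3 | h3 <;> rcases lt_or_gt_of_ne l.2 with h4 | h4 <;>
    simp only [min_eq_left h3.le, min_eq_left h4.le, min_eq_right h3.le, min_eq_right h4.le,
      max_eq_left h3.le, max_eq_left h4.le, max_eq_right h3.le, max_eq_right h4.le] at h1 h2 <;>
    omega

lemma upperPair_avoids {j k l : Fin N} (hk : k ≠ j) (hl : l ≠ j) :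
    min k l ≠ j ∧ max k l ≠ j := by
  constructor
  · rcases min_choice k l with h | h <;> rwa [h]
  · rcases max_choice k l with h | h <;> rwa [h]

lemma upperPair_meets (j k : Fin N) : min k j = j ∨ max k j = j :=
  (le_total k j).elim (fun h => Or.inr (max_eq_right h)) fun h => Or.inl (min_eq_right h)

lemma sum_normSq_subtype_le (A : Matrix (Fin N) (Fin N) ℂ) (j : Fin N) :
    ∑ k : {k // k ≠ j}, ∑ l : {k // k ≠ j}, Complex.normSq (A k.1 l.1)
      ≤ ∑ k, ∑ l, Complex.normSq (A k l) := by
  rw [← sum_ite_ne j fun k => ∑ l : {k // k ≠ j}, Complex.normSq (A k l.1)]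
  refine Finset.sum_le_sum fun k _ => ?_
  split_ifs
  · exact Finset.sum_nonneg fun _ _ => Complex.normSq_nonneg _
  · rw [← sum_ite_ne j fun l => Complex.normSq (A k l)]
    refine Finset.sum_le_sum fun l _ => ?_
    split_ifs
    · exact Complex.normSq_nonneg _
    · exact le_rfl

/-- A quadratic form in the column `j` only involves the indices different from `j`. -/
lemma quadForm_offCol (A H : Matrix (Fin N) (Fin N) ℂ) (j : Fin N) :
    quadForm A (offCol H j) = ∑ k : {k // k ≠ j}, ∑ l : {k // k ≠ j},
      starRingEnd ℂ (H k.1 j) * A k.1 l.1 * H l.1 j := by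
  rw [quadForm, ← sum_ite_ne j fun k => ∑ l : {k // k ≠ j},
    starRingEnd ℂ (H k j) * A k l.1 * H l.1 j]
  refine Finset.sum_congr rfl fun k _ => ?_
  split_ifs with hk
  · simp [offCol, hk]
  · rw [← sum_ite_ne j fun l => starRingEnd ℂ (H k j) * A k l * H l j]
    refine Finset.sum_congr rfl fun l _ => ?_
    split_ifs with hl
    · simp [offCol, hl]
    · rw [offCol, offCol, if_neg hk, if_neg hl]

lemma rpow_neg_half_sq (N : ℕ) : (((N : ℝ) ^ (-(1 / 2) : ℝ) : ℝ)) ^ 2 = 1 / N := by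
  rw [← Real.rpow_two, ← Real.rpow_mul (Nat.cast_nonneg _), neg_mul, one_div,
    inv_mul_cancel₀ two_ne_zero, Real.rpow_neg (Nat.cast_nonneg _), Real.rpow_one, one_div]

lemma rpow_neg_half_mul_sqrt (hN : 0 < N) : (N : ℝ) ^ (-(1 / 2) : ℝ) * √N = 1 := by
  rw [Real.sqrt_eq_rpow, ← Real.rpow_add (by exact_mod_cast hN), neg_add_cancel, Real.rpow_zero]

lemma norm_rpow_mul_ge_iff (hN : 0 < N) (t x : ℝ) :
    t ≤ ‖(((N : ℝ) ^ (-(1 / 2) : ℝ) * x : ℝ) : ℂ)‖ ↔ t * √N ≤ |x| := by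
  have hpos : 0 < √(N : ℝ) := Real.sqrt_pos.mpr (by exact_mod_cast hN)
  have h := rpow_neg_half_mul_sqrt hN
  rw [Complex.norm_real, Real.norm_eq_abs, abs_mul,
    abs_of_nonneg (Real.rpow_nonneg (Nat.cast_nonneg _) _), ← mul_le_mul_iff_left₀ hpos,
    mul_right_comm, h, one_mul]

/-- A column of a symmetric Wigner matrix is `N ^ (-1/2)` times a vector of independent variables. -/
lemma isWignerLike_symmetricMatrix {ν νd : Measure ℝ} [IsProbabilityMeasure ν] {C c D : ℝ}
    (hC : 0 < C) (hc : 0 < c) (hD : 0 < D) (hquad : QuadraticConcentration ν 1 C c)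
    (hdiag : ∀ t : ℝ, νd.real {x | t ≤ |x|} ≤ D * Real.exp (-t))
    {Ω : Type*} [MeasurableSpace Ω] {P : Measure Ω} [IsProbabilityMeasure P]
    {x : Fin N → Fin N → Ω → ℝ} (hx : IsSymmetricEntries P ν νd x) :
    IsWignerLike P (fun ω => symmetricMatrix fun l k => x l k ω) (C + D) (min c 1) := by
  set X : {q : Fin N × Fin N // q.1 ≤ q.2} → Ω → ℝ := fun q => x q.1.1 q.1.2 with hX
  have hXm : ∀ q, Measurable (X q) := fun q => hx.measurable _ _ q.2
  have hH : ∀ ω k l, symmetricMatrix (fun l k => x l k ω) k l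
      = (((N : ℝ) ^ (-(1 / 2) : ℝ) * X (upperPair k l) ω : ℝ) : ℂ) := fun ω k l => rfl
  refine ⟨fun ω => isHermitian_symmetricMatrix _, fun k l => ?_, fun j => ?_, ?_, ?_⟩
  · simp only [hH]
    exact Complex.measurable_ofReal.comp ((hXm _).const_mul _)
  · refine indepFun_of_measurable_iSup hXm hx.indep
      (S := {q | q.1.1 ≠ j ∧ q.1.2 ≠ j}) (T := {q | q.1.1 = j ∨ q.1.2 = j}) ?_ ?_ ?_
    · rw [Set.disjoint_left]
      rintro q ⟨h1, h2⟩ (h | h)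
      · exact h1 h
      · exact h2 h
    · refine @measurable_pi_lambda _ _ _ (_) _ _ fun k =>
        @measurable_pi_lambda _ _ _ (_) _ _ fun l => ?_
      simp only [minor, Matrix.of_apply, hH]
      split_ifs with h
      · exact @measurable_const _ _ _ (_) _
      · push Not at h
        refine Complex.measurable_ofReal.comp
          (@Measurable.const_mul _ _ _ _ _ (_) _ (measurable_iSup_comap ?_) _)
        exact upperPair_avoids h.1 h.2
    · refine @measurable_pi_lambda _ _ _ (_) _ _ fun k => ?_
      simp only [offCol, hH]
      split_ifs with h
      · exact @measurable_const _ _ _ (_) _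
      · refine Complex.measurable_ofReal.comp
          (@Measurable.const_mul _ _ _ _ _ (_) _ (measurable_iSup_comap ?_) _)
        exact upperPair_meets j k
  · intro j A r t hr ht hA
    have hN : 0 < N := j.pos
    have hN' : (0 : ℝ) < N := by exact_mod_cast hN
    set n : ℝ := (N : ℝ) ^ (-(1 / 2) : ℝ) with hn
    have hsq : (n : ℂ) ^ 2 = 1 / N := by
      rw [← Complex.ofReal_pow, hn, rpow_neg_half_sq]
      simp
    have htail := hquad.tail (P := P) (w := fun k : {k // k ≠ j} => X (upperPair k.1 j))
      (fun k => hXm _) (fun k => hx.law_offdiag _ _ (min_lt_max.mpr k.2))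
      (hx.indep.precomp (upperPair_injective j)) (fun k l => A k.1 l.1 / N) (r := r / N) (t := t)
      (by positivity) ht (by
        rw [div_pow]
        simp only [Complex.normSq_div, Complex.normSq_natCast, ← Finset.sum_div, ← pow_two]
        gcongr
        exact (sum_normSq_subtype_le A j).trans hA)
    have hq : ∀ ω, quadForm A (offCol (symmetricMatrix fun l k => x l k ω) j)
        = ∑ k : {k // k ≠ j}, ∑ l : {k // k ≠ j}, A k.1 l.1 / N * X (upperPair k.1 j) ω
          * X (upperPair l.1 j) ω := by
      intro ω
      rw [quadForm_offCol]
      refine Finset.sum_congr rfl fun k _ => Finset.sum_congr rfl fun l _ => ?_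
      rw [hH, hH, Complex.conj_ofReal]
      push_cast
      linear_combination (X (upperPair k j) ω * A k l * X (upperPair l j) ω) * hsq
    have htr : offTrace A j / N = ((1 : ℝ) : ℂ) * ∑ k : {k // k ≠ j}, A k.1 k.1 / N := by
      rw [offTrace, sum_ite_ne, Finset.sum_div, Complex.ofReal_one, one_mul]
    simp only [hq, htr]
    refine htail.trans ?_
    have h1 : -c * t / (r / N) = -(c * (t * N / r)) := by field_simp
    have h2 : -(min c 1) * (t * N) / r = -(min c 1 * (t * N / r)) := by ring
    rw [h1, h2]
    gcongr
    · linarith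
    · exact min_le_left _ _
  · intro j t ht
    have hN : 0 < N := j.pos
    have h1 : P.real {ω | t ≤ ‖symmetricMatrix (fun l k => x l k ω) j j‖}
        = νd.real {y | t * √N ≤ |y|} := by
      rw [← hx.law_diag j, map_measureReal_apply (hx.measurable j j le_rfl)
        (measurableSet_le measurable_const (by fun_prop))]
      congr 1
      ext ω
      simp only [Set.mem_ofPred_eq, Set.mem_preimage, hH]
      rw [norm_rpow_mul_ge_iff hN]
      simp [hX, upperPair]
    rw [h1]
    refine (hdiag _).trans ?_
    have h3 : -(t * √N) ≤ -(min c 1) * t * √N := by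
      have := mul_le_mul_of_nonneg_right (min_le_right c 1) (mul_nonneg ht (Real.sqrt_nonneg N))
      linarith
    gcongr
    linarith

lemma isHermitian_hermitianMatrix (x y : Fin N → Fin N → ℝ) :
    (hermitianMatrix x y).IsHermitian := by
  ext k l
  simp only [hermitianMatrix, Matrix.conjTranspose_apply, Matrix.of_apply, RCLike.star_def,
    map_mul, Complex.conj_ofReal]
  rcases lt_trichotomy k l with h | h | h
  · simp [h, h.not_gt]
  · subst h
    simp
  · simp [h, h.not_gt, sub_eq_add_neg]

/-- The pair of indices of the entry `{j, k}` above the diagonal. -/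
def strictPair {j k : Fin N} (h : j ≠ k) : {q : Fin N × Fin N // q.1 < q.2} :=
  ⟨(min j k, max j k), min_lt_max.mpr h⟩

/-- The sign of the imaginary part of the entry `(k, j)` relative to the entry above the
diagonal. -/
def entrySign (k j : Fin N) : ℝ := if k < j then 1 else -1

lemma entrySign_mul_self (k j : Fin N) : entrySign k j * entrySign k j = 1 := by
  unfold entrySign
  split_ifs <;> norm_num

lemma hermitianMatrix_apply_of_ne (x y : Fin N → Fin N → ℝ) {k j : Fin N} (h : k ≠ j) :
    hermitianMatrix x y k j = (((N : ℝ) ^ (-(1 / 2) : ℝ) : ℝ) : ℂ) *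
      (x (min k j) (max k j) + Complex.I * entrySign k j * y (min k j) (max k j)) := by
  simp only [hermitianMatrix, Matrix.of_apply, entrySign]
  rcases lt_or_gt_of_ne h with h | h
  · simp [h, min_eq_left h.le, max_eq_right h.le]
  · simp only [h, h.not_gt, min_eq_right h.le, max_eq_left h.le, if_false, if_true]
    push_cast
    ring

lemma hermitianMatrix_apply_self (x y : Fin N → Fin N → ℝ) (j : Fin N) :
    hermitianMatrix x y j j = (((N : ℝ) ^ (-(1 / 2) : ℝ) * x j j : ℝ) : ℂ) := by
  simp [hermitianMatrix]

lemma measurable_hermitianMatrix_apply {Ω : Type*} [MeasurableSpace Ω]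
    {x y : Fin N → Fin N → Ω → ℝ} {k l : Fin N} (hx : Measurable (x (min k l) (max k l)))
    (hy : k ≠ l → Measurable (y (min k l) (max k l))) :
    Measurable fun ω => hermitianMatrix (fun l k => x l k ω) (fun l k => y l k ω) k l := by
  by_cases h : k = l
  · subst h
    simp only [min_self, max_self] at hx
    simp only [hermitianMatrix_apply_self]
    exact Complex.measurable_ofReal.comp (hx.const_mul _)
  · simp only [hermitianMatrix_apply_of_ne _ _ h]
    have := hy h
    fun_prop

/-- In the hermitian case the quadratic form in a column is a quadratic form in twice as many real
variables. The squared Hilbert-Schmidt norm of its coefficients is four times the original one, which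
halves the exponent. -/
lemma isWignerLike_hermitianMatrix {ν νd : Measure ℝ} [IsProbabilityMeasure ν] {C c D : ℝ}
    (hC : 0 < C) (hc : 0 < c) (hD : 0 < D) (hquad : QuadraticConcentration ν (1 / 2) C c)
    (hdiag : ∀ t : ℝ, νd.real {x | t ≤ |x|} ≤ D * Real.exp (-t))
    {Ω : Type*} [MeasurableSpace Ω] {P : Measure Ω} [IsProbabilityMeasure P]
    {x y : Fin N → Fin N → Ω → ℝ} (hx : IsHermitianEntries P ν νd x y) :
    IsWignerLike P (fun ω => hermitianMatrix (fun l k => x l k ω) (fun l k => y l k ω))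
      (C + D) (min (c / 2) 1) := by
  set X : {q : Fin N × Fin N // q.1 ≤ q.2} ⊕ {q : Fin N × Fin N // q.1 < q.2} → Ω → ℝ :=
    Sum.elim (fun q => x q.1.1 q.1.2) (fun q => y q.1.1 q.1.2) with hX
  have hXm : ∀ q, Measurable (X q) := by
    rintro (q | q)
    · exact hx.measurable_re _ _ q.2
    · exact hx.measurable_im _ _ q.2
  refine ⟨fun ω => isHermitian_hermitianMatrix _ _, fun k l => ?_, fun j => ?_, ?_, ?_⟩
  · exact measurable_hermitianMatrix_apply (hx.measurable_re _ _ min_le_max)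
      fun h => hx.measurable_im _ _ (min_lt_max.mpr h)
  · set pr : {q : Fin N × Fin N // q.1 ≤ q.2} ⊕ {q : Fin N × Fin N // q.1 < q.2} →
      Fin N × Fin N := Sum.elim Subtype.val Subtype.val with hpr
    refine indepFun_of_measurable_iSup hXm hx.indep
      (S := {q | (pr q).1 ≠ j ∧ (pr q).2 ≠ j}) (T := {q | (pr q).1 = j ∨ (pr q).2 = j}) ?_ ?_ ?_
    · rw [Set.disjoint_left]
      rintro q ⟨h1, h2⟩ (h | h)
      · exact h1 h
      · exact h2 h
    · refine @measurable_pi_lambda _ _ _ (_) _ _ fun k =>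
        @measurable_pi_lambda _ _ _ (_) _ _ fun l => ?_
      simp only [minor, Matrix.of_apply]
      split_ifs with h
      · exact @measurable_const _ _ _ (_) _
      · push Not at h
        exact @measurable_hermitianMatrix_apply _ _ (_) _ _ _ _
          (measurable_iSup_comap (X := X) (i := Sum.inl (upperPair k l)) (upperPair_avoids h.1 h.2))
          fun hkl => measurable_iSup_comap (X := X) (i := Sum.inr (strictPair hkl))
            (upperPair_avoids h.1 h.2)
    · refine @measurable_pi_lambda _ _ _ (_) _ _ fun k => ?_
      simp only [offCol]
      split_ifs with h
      · exact @measurable_const _ _ _ (_) _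
      · exact @measurable_hermitianMatrix_apply _ _ (_) _ _ _ _
          (measurable_iSup_comap (X := X) (i := Sum.inl (upperPair k j)) (upperPair_meets j k))
          fun hkl => measurable_iSup_comap (X := X) (i := Sum.inr (strictPair hkl))
            (upperPair_meets j k)
  · intro j A r t hr ht hA
    have hN : 0 < N := j.pos
    have hN' : (0 : ℝ) < N := by exact_mod_cast hN
    set n : ℝ := (N : ℝ) ^ (-(1 / 2) : ℝ) with hn
    have hsq : (n : ℂ) ^ 2 = 1 / N := by
      rw [← Complex.ofReal_pow, hn, rpow_neg_half_sq]
      simp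
    -- column `j` is `n` times a linear combination of independent real variables, two for each row
    set emb : {k // k ≠ j} ⊕ {k // k ≠ j} →
        {q : Fin N × Fin N // q.1 ≤ q.2} ⊕ {q : Fin N × Fin N // q.1 < q.2} :=
      Sum.map (fun k => upperPair k.1 j) (fun k => strictPair k.2) with hemb
    have hinj : Function.Injective emb := by
      refine Sum.map_injective.mpr ⟨upperPair_injective j, fun k l h => upperPair_injective j ?_⟩
      have h' : strictPair k.2 = strictPair l.2 := h
      exact Subtype.ext (congrArg (fun q => q.1) h')
    set α : {k // k ≠ j} ⊕ {k // k ≠ j} → ℂ :=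
      Sum.elim (fun _ => 1) (fun k => Complex.I * entrySign k.1 j) with hα
    set row : {k // k ≠ j} ⊕ {k // k ≠ j} → Fin N := Sum.elim Subtype.val Subtype.val with hrow
    have hαn : ∀ i, Complex.normSq (α i) = 1 := by
      rintro (k | k)
      · simp [hα]
      · simp [hα, Complex.normSq_ofReal, entrySign_mul_self]
    have htail := hquad.tail (P := P) (w := fun i => X (emb i)) (fun i => hXm _) (by
        rintro (k | k)
        · exact hx.law_re _ _ (min_lt_max.mpr k.2)
        · exact hx.law_im _ _ (min_lt_max.mpr k.2)) (hx.indep.precomp hinj)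
      (fun i i' => starRingEnd ℂ (α i) * A (row i) (row i') * α i' / N) (r := 2 * r / N) (t := t)
      (by positivity) ht (by
        simp only [Complex.normSq_div, Complex.normSq_natCast, Complex.normSq_mul,
          Complex.normSq_conj, hαn, one_mul, mul_one, ← Finset.sum_div]
        simp only [Fintype.sum_sum_type, hrow, Sum.elim_inl, Sum.elim_inr]
        rw [div_pow, ← pow_two]
        gcongr
        have := sum_normSq_subtype_le A j
        simp only [Finset.sum_add_distrib]
        nlinarith)
    have hq : ∀ ω, quadForm A (offCol (hermitianMatrix (fun l k => x l k ω) (fun l k => y l k ω)) j)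
        = ∑ i, ∑ i', starRingEnd ℂ (α i) * A (row i) (row i') * α i' / N * X (emb i) ω
          * X (emb i') ω := by
      intro ω
      rw [quadForm_offCol]
      simp only [Fintype.sum_sum_type, ← Finset.sum_add_distrib]
      refine Finset.sum_congr rfl fun k _ => Finset.sum_congr rfl fun l _ => ?_
      rw [hermitianMatrix_apply_of_ne _ _ k.2, hermitianMatrix_apply_of_ne _ _ l.2]
      simp only [hα, hrow, hemb, hX, Sum.elim_inl, Sum.elim_inr, Sum.map_inl, Sum.map_inr,
        upperPair, strictPair, map_mul, map_add, Complex.conj_ofReal, Complex.conj_I, map_one]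
      rw [← hn]
      linear_combination ((x (min k.1 j) (max k.1 j) ω
        - Complex.I * entrySign k.1 j * y (min k.1 j) (max k.1 j) ω) * A k l *
        (x (min l.1 j) (max l.1 j) ω
        + Complex.I * entrySign l.1 j * y (min l.1 j) (max l.1 j) ω)) * hsq
    have htr : offTrace A j / N
        = ((1 / 2 : ℝ) : ℂ) * ∑ i, starRingEnd ℂ (α i) * A (row i) (row i) * α i / N := by
      have h1 : ∀ i, starRingEnd ℂ (α i) * A (row i) (row i) * α i / N = A (row i) (row i) / N := by
        intro i
        have := Complex.normSq_eq_conj_mul_self (z := α i)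
        rw [hαn, Complex.ofReal_one] at this
        linear_combination (-A (row i) (row i) / N) * this
      simp only [h1]
      simp only [Fintype.sum_sum_type, hrow, Sum.elim_inl, Sum.elim_inr]
      rw [offTrace, sum_ite_ne, Finset.sum_div]
      push_cast
      ring
    simp only [hq, htr]
    refine htail.trans ?_
    have h1 : -c * t / (2 * r / N) = -(c / 2 * (t * N / r)) := by field_simp
    have h2 : -(min (c / 2) 1) * (t * N) / r = -(min (c / 2) 1 * (t * N / r)) := by ring
    rw [h1, h2]
    gcongr
    · linarith
    · exact min_le_left _ _
  · intro j t ht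
    have hN : 0 < N := j.pos
    have h1 : P.real {ω | t ≤ ‖hermitianMatrix (fun l k => x l k ω) (fun l k => y l k ω) j j‖}
        = νd.real {y | t * √N ≤ |y|} := by
      rw [← hx.law_diag j, map_measureReal_apply (hx.measurable_re j j le_rfl)
        (measurableSet_le measurable_const (by fun_prop))]
      congr 1
      ext ω
      simp only [Set.mem_ofPred_eq, Set.mem_preimage, hermitianMatrix_apply_self]
      rw [norm_rpow_mul_ge_iff hN]
    rw [h1]
    refine (hdiag _).trans ?_
    have h3 : -(t * √N) ≤ -(min (c / 2) 1) * t * √N := by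
      have := mul_le_mul_of_nonneg_right (min_le_right (c / 2) 1)
        (mul_nonneg ht (Real.sqrt_nonneg N))
      linarith
    gcongr
    linarith

end WignerDeloc

theorem mainTheorem5 :
    -- real symmetric Wigner matrices
    (∀ ν νd : Measure ℝ,
      WignerDeloc.IsCenteredLaw ν 1 → WignerDeloc.IsCenteredLaw νd 2 →
      WignerDeloc.HasGaussianDecay ν νd →
      ∀ E K p : ℝ, |E| < 2 → 2 < p →
        ∃ C c M₀ : ℝ, ∃ N₀ : ℕ, 0 < C ∧ 0 < c ∧
          ∀ N : ℕ, N₀ ≤ N → ∀ M : ℝ, M₀ ≤ M →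
            ∀ (Ω : Type*) [MeasurableSpace Ω] (P : Measure Ω) [IsProbabilityMeasure P]
              (x : Fin N → Fin N → Ω → ℝ), WignerDeloc.IsSymmetricEntries P ν νd x →
              P.real {ω | WignerDeloc.HasLocalizedEigenvector
                  (WignerDeloc.symmetricMatrix (fun l k => x l k ω)) E K p M}
                ≤ C * Real.exp (-c * Real.sqrt M)) ∧
    -- complex hermitian Wigner matrices
    (∀ ν νd : Measure ℝ,
      WignerDeloc.IsCenteredLaw ν (1 / 2) → WignerDeloc.IsCenteredLaw νd 1 →
      WignerDeloc.HasGaussianDecay ν νd →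
      ∀ E K p : ℝ, |E| < 2 → 2 < p →
        ∃ C c M₀ : ℝ, ∃ N₀ : ℕ, 0 < C ∧ 0 < c ∧
          ∀ N : ℕ, N₀ ≤ N → ∀ M : ℝ, M₀ ≤ M →
            ∀ (Ω : Type*) [MeasurableSpace Ω] (P : Measure Ω) [IsProbabilityMeasure P]
              (x y : Fin N → Fin N → Ω → ℝ), WignerDeloc.IsHermitianEntries P ν νd x y →
              P.real {ω | WignerDeloc.HasLocalizedEigenvector
                  (WignerDeloc.hermitianMatrix (fun l k => x l k ω) (fun l k => y l k ω)) E K p M}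
                ≤ C * Real.exp (-c * Real.sqrt M)) := by
  refine ⟨fun ν νd hν hνd hdecay E K p hE hp => ?_, fun ν νd hν hνd hdecay E K p hE hp => ?_⟩
  · obtain ⟨δ₀, hδ₀, h1, h2⟩ := hdecay
    have := hν.isProbabilityMeasure
    obtain ⟨C, c, hC, hc, hquad⟩ := WignerDeloc.exists_quadraticConcentration hν hδ₀ h1
    obtain ⟨D, hD, hdiag⟩ := WignerDeloc.exists_exp_tail hνd hδ₀ h2
    obtain ⟨C', c', M₀, hC', hc', h⟩ := WignerDeloc.exists_delocalization (K := K) hE hp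
      (add_pos hC hD) (lt_min hc one_pos)
    exact ⟨C', c', M₀, 0, hC', hc', fun N _ M hM Ω _ P _ x hx => h N M hM Ω P _
      (WignerDeloc.isWignerLike_symmetricMatrix hC hc hD hquad hdiag hx)⟩
  · obtain ⟨δ₀, hδ₀, h1, h2⟩ := hdecay
    have := hν.isProbabilityMeasure
    obtain ⟨C, c, hC, hc, hquad⟩ := WignerDeloc.exists_quadraticConcentration hν hδ₀ h1
    obtain ⟨D, hD, hdiag⟩ := WignerDeloc.exists_exp_tail hνd hδ₀ h2
    obtain ⟨C', c', M₀, hC', hc', h⟩ := WignerDeloc.exists_delocalization (K := K) hE hp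
      (add_pos hC hD) (lt_min (half_pos hc) one_pos)
    exact ⟨C', c', M₀, 0, hC', hc', fun N _ M hM Ω _ P _ x y hx => h N M hM Ω P _
      (WignerDeloc.isWignerLike_hermitianMatrix hC hc hD hquad hdiag hx)⟩
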